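/- **Setting.** Work in differential dynamic logic with terms $e ::= x \mid c \mid e+\tilde e \mid e\cdot\tilde e \mid h(e_1,\dots,e_k) \mid (e)'$ over rational constants $c$ and finitely many fixed function symbols $h$, interpreted as $C^\infty$ functions $h:\mathbb R^k\to\mathbb R$ whose partial derivatives are represented by differential-free terms. Every variable $x$ has a differential variable $x'$. Semianalytic formulas are the formulas without quantifiers and modalities, built with $\land,\lor,\lnot$ from comparisons ($=,\ge,>$) of differential-free terms. Let $x'=f(x)$ be a system $x_1'=f_1,\dots,x_n'=f_n$ with distinct $x_i$ and differential-free $f_i$ (which may contain parameters); assume that it *locally evolves* $x$, i.e. $f(x)$ is nowhere the zero vector. The Lie derivative of a differential-free term $e$ is the term $\dot e=\sum_{i=1}^n \frac{\partial e}{\partial x_i} f_i$, and $e^{(i)}$ is its $i$-th iterate. Derivability $\vdash$ is derivability in the classical sequent calculus with cut and quantifier rules; the rule that proves substitution instances of valid formulas of first-order real arithmetic; the usual dynamic-logic axioms and rules (duality of $[\cdot]$ and $\langle\cdot\rangle$, K, generalization, vacuity, assignment); the differential axioms; and the axioms for differential equations: differential effect, weakening, skip, modus ponens for domain constraints, Barcan,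 differential invariants (DI), differential cuts (DC) and scalar differential ghosts (DG); together with an arbitrary set $T$ of further axioms that contains all instances of * (Cont) $x=y \to \big(\langle x'=g(x)\,\&\,e>0\rangle\, x\neq y \leftrightarrow e>0\big)$, for systems $x'=g(x)$ that locally evolve $x$, differential-free terms $e$, and $y$ fresh in both; * (Uniq) $\langle x'=g(x)\,\&\,Q_1\land Q_2\rangle \phi \leftrightarrow \langle x'=g(x)\,\&\,Q_1\rangle \phi\land\langle x'=g(x)\,\&\,Q_2\rangle \phi$. (In DI, variables of $e$ that do not evolve are treated as constants: their differential variables are assumed to be $0$. Taking for $T$ just the instances of Cont and Uniq gives derivability from Cont and Uniq.) Assume that differential radicals exist: for every differential-free term $e$ and every differential equation there are $N\ge1$ (a *rank* of $e$) and differential-free terms $g_i$ with $\vdash e^{(N)}=\sum_{i<N} g_i e^{(i)}$. **Progress formulas.** For $e$ of rank $N$ let $$\dot e^{(*)}{=}0\;:=\;\bigwedge_{i<N} e^{(i)}=0,\qquad \dot e^{(*)}{>}0\;:=\;\bigwedge_{k<N-1}\Big(\bigwedge_{i<k}e^{(i)}=0\to e^{(k)}\ge0\Big)\land\Big(\bigwedge_{i<N-1}e^{(i)}=0\to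 e^{(N-1)}>0\Big),$$ and $\dot e^{(*)}{\ge}0 := \dot e^{(*)}{>}0\lor \dot e^{(*)}{=}0$. If $P$ is provably equivalent to the normal form $\bigvee_i\big(\bigwedge_j e_{ij}\ge0\land\bigwedge_j\tilde e_{ij}>0\big)$, then $\dot P^{(*)} := \bigvee_i\big(\bigwedge_j \dot e_{ij}^{(*)}{\ge}0\land\bigwedge_j\dot{\tilde e}_{ij}^{(*)}{>}0\big)$ is called a *progress formula* of $P$ along $x'=f(x)$ (for any such normal form and any choice of ranks of its terms). The local progress modality is $$\bigcirc P\;:=\;\langle x'=f(x)\,\&\,P\lor x=y\rangle\; x\neq y .$$ **Theorem.** Let $P,R$ be semianalytic formulas. 1. $P$ has a progress formula. 2. (Local progress completeness) For every progress formula $\dot P^{(*)}$ of $P$ and every vector $y$ of variables that is fresh in $x'=f(x)$ and $P$, the formula $\dot P^{(*)}$ is semianalytic and $\vdash x=y\to\big(\bigcirc P\leftrightarrow \dot P^{(*)}\big)$. 3. (Duality) For every vector $y$ of variables that is fresh in $x'=f(x)$ and $P$, $\vdash x=y\to\big(\bigcirc P\leftrightarrow\lnot\bigcirc\lnot P\big)$.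 4. (Congruence) If $\vdash P\leftrightarrow R$, then $\vdash \dot P^{(*)}\leftrightarrow\dot R^{(*)}$ for all progress formulas $\dot P^{(*)}$ of $P$ and $\dot R^{(*)}$ of $R$. -/

import Mathlib

namespace DL

/-! ### Syntax -/

/-- Variables of differential dynamic logic.  The set of variables is closed under the passage from
`x` to its differential variable `x'`; the variables of order `0` are the ordinary ones. -/
structure Var where
  name : ℕ
  order : ℕ
deriving DecidableEq

/-- The ordinary variable with a given name. -/
def Var.base (n : ℕ) : Var := ⟨n, 0⟩

/-- The differential variable `v'` of `v`. -/
def Var.prime (v : Var) : Var := ⟨v.name, v.order + 1⟩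

/-- Finitely many fixed function symbols with their arities and their fixed interpretations. -/
structure Signature where
  r : ℕ
  arity : Fin r → ℕ
  interp : (h : Fin r) → (Fin (arity h) → ℝ) → ℝ

/-- Terms `x | c | e + e | e · e | h(e₁,…,e_k) | (e)'`. -/
inductive Term (S : Signature) : Type
  | var (v : Var) : Term S
  | const (c : ℚ) : Term S
  | add (e d : Term S) : Term S
  | mul (e d : Term S) : Term S
  | app (h : Fin S.r) (es : Fin (S.arity h) → Term S) : Term S
  | diff (e : Term S) : Term S

/-- Comparison operators `=`, `≥`, `>`. -/
inductive Cmp : Type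
  | eq | ge | gt

/-- Formulas without quantifiers and modalities.  They are the semianalytic formulas as soon as
their terms are differential-free (`SAFormula.DiffFree` below). -/
inductive SAFormula (S : Signature) : Type
  | cmp (c : Cmp) (e d : Term S) : SAFormula S
  | and (P Q : SAFormula S) : SAFormula S
  | or (P Q : SAFormula S) : SAFormula S
  | not (P : SAFormula S) : SAFormula S

/-- A vectorial differential equation `x₁' = f₁, …, x_n' = f_n`, as the list of the pairs
`(name of x_i, f_i)`. -/
abbrev ODE (S : Signature) := List (ℕ × Term S)

/-- Programs: assignments `v := e` and differential equations `x' = f(x) & Q` with evolution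
domain constraint `Q`. -/
inductive Program (S : Signature) : Type
  | assign (v : Var) (e : Term S) : Program S
  | ode (E : ODE S) (Q : SAFormula S) : Program S

/-- Formulas of differential dynamic logic. -/
inductive Formula (S : Signature) : Type
  | cmp (c : Cmp) (e d : Term S) : Formula S
  | and (φ ψ : Formula S) : Formula S
  | or (φ ψ : Formula S) : Formula S
  | not (φ : Formula S) : Formula S
  | all (v : Var) (φ : Formula S) : Formula S
  | ex (v : Var) (φ : Formula S) : Formula S
  | box (α : Program S) (φ : Formula S) : Formula S
  | dia (α : Program S) (φ : Formula S) : Formula S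

section Syntactic

variable {S : Signature}

def SAFormula.toFormula : SAFormula S → Formula S
  | .cmp c e d => .cmp c e d
  | .and P Q => .and P.toFormula Q.toFormula
  | .or P Q => .or P.toFormula Q.toFormula
  | .not P => .not P.toFormula

/-- Truth, as the formula `0 = 0`. -/
def SAFormula.tt : SAFormula S := .cmp .eq (.const 0) (.const 0)
def SAFormula.ff : SAFormula S := .not .tt
def SAFormula.imp (P Q : SAFormula S) : SAFormula S := .or (.not P) Q

def Formula.tt : Formula S := .cmp .eq (.const 0) (.const 0)
def Formula.ff : Formula S := .not .tt
def Formula.imp (φ ψ : Formula S) : Formula S := .or (.not φ) ψ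
def Formula.iff (φ ψ : Formula S) : Formula S := .and (φ.imp ψ) (ψ.imp φ)

/-- Finite conjunction; the empty conjunction is true. -/
def SAFormula.bigAnd : List (SAFormula S) → SAFormula S
  | [] => .tt
  | [P] => P
  | P :: Q :: l => .and P (bigAnd (Q :: l))

/-- Finite disjunction; the empty disjunction is false. -/
def SAFormula.bigOr : List (SAFormula S) → SAFormula S
  | [] => .ff
  | [P] => P
  | P :: Q :: l => .or P (bigOr (Q :: l))

/-- Finite sums of terms. -/
def Term.sum : List (Term S) → Term S
  | [] => .const 0
  | [e] => e
  | e :: d :: l => .add e (Term.sum (d :: l))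

/-- The term is differential-free: it contains neither differentials nor differential variables. -/
def Term.DiffFree : Term S → Prop
  | .var v => v.order = 0
  | .const _ => True
  | .add e d => e.DiffFree ∧ d.DiffFree
  | .mul e d => e.DiffFree ∧ d.DiffFree
  | .app _ es => ∀ i, (es i).DiffFree
  | .diff _ => False

/-- The term is polynomial in its variables. -/
def Term.IsPoly : Term S → Prop
  | .var _ => True
  | .const _ => True
  | .add e d => e.IsPoly ∧ d.IsPoly
  | .mul e d => e.IsPoly ∧ d.IsPoly
  | .app _ _ => False
  | .diff _ => False

def SAFormula.DiffFree : SAFormula S → Prop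
  | .cmp _ e d => e.DiffFree ∧ d.DiffFree
  | .and P Q => P.DiffFree ∧ Q.DiffFree
  | .or P Q => P.DiffFree ∧ Q.DiffFree
  | .not P => P.DiffFree

/-- The formula is a formula of first-order real arithmetic. -/
def Formula.IsArith : Formula S → Prop
  | .cmp _ e d => e.IsPoly ∧ d.IsPoly
  | .and φ ψ => φ.IsArith ∧ ψ.IsArith
  | .or φ ψ => φ.IsArith ∧ ψ.IsArith
  | .not φ => φ.IsArith
  | .all _ φ => φ.IsArith
  | .ex _ φ => φ.IsArith
  | .box _ _ => False
  | .dia _ _ => False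

/-! Free and bound variables. -/

/-- Free variables of a term.  The value of `(e)'` depends on the variables of `e` and on their
differential variables. -/
def Term.fv : Term S → Finset Var
  | .var v => {v}
  | .const _ => ∅
  | .add e d => e.fv ∪ d.fv
  | .mul e d => e.fv ∪ d.fv
  | .app _ es => Finset.univ.biUnion fun i => (es i).fv
  | .diff e => e.fv ∪ e.fv.image Var.prime

def SAFormula.fv : SAFormula S → Finset Var
  | .cmp _ e d => e.fv ∪ d.fv
  | .and P Q => P.fv ∪ Q.fv
  | .or P Q => P.fv ∪ Q.fv
  | .not P => P.fv

/-- The names of the evolving variables `x₁, …, x_n`. -/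
def ODE.names (E : ODE S) : List ℕ := E.map Prod.fst

/-- The variables occurring in the right-hand sides. -/
def ODE.rhsFv (E : ODE S) : Finset Var := (E.map fun p => p.2.fv).foldr (· ∪ ·) ∅

/-- The variables that change along the differential equation: `x_i` and `x_i'`. -/
def ODE.bv (E : ODE S) : Finset Var :=
  (E.names.map Var.base).toFinset ∪ (E.names.map fun n => (Var.base n).prime).toFinset

/-- The `x_i` are pairwise distinct and the right-hand sides are differential-free. -/
def ODE.WF (E : ODE S) : Prop := E.names.Nodup ∧ ∀ p ∈ E, p.2.DiffFree

def Program.bv : Program S → Finset Var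
  | .assign v _ => {v}
  | .ode E _ => E.bv

def Program.fv : Program S → Finset Var
  | .assign _ e => e.fv
  | .ode E Q => (E.names.map Var.base).toFinset ∪ E.rhsFv ∪ Q.fv

def Formula.fv : Formula S → Finset Var
  | .cmp _ e d => e.fv ∪ d.fv
  | .and φ ψ => φ.fv ∪ ψ.fv
  | .or φ ψ => φ.fv ∪ ψ.fv
  | .not φ => φ.fv
  | .all v φ => φ.fv.erase v
  | .ex v φ => φ.fv.erase v
  | .box α φ => α.fv ∪ (φ.fv \ α.bv)
  | .dia α φ => α.fv ∪ (φ.fv \ α.bv)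

/-! Simultaneous substitution of terms for free variables.  `subst` is the result of a substitution
and `Adm` says that the substitution is admissible, i.e. that no variable is captured. -/

/-- The substitution that replaces only `v`, by `e`. -/
def single (v : Var) (e : Term S) : Var → Term S := Function.update Term.var v e

/-- The substitution `σ`, switched off on the variables in `B`. -/
def reset (σ : Var → Term S) (B : Finset Var) : Var → Term S :=
  fun w => if w ∈ B then .var w else σ w

def Term.subst (σ : Var → Term S) : Term S → Term S
  | .var v => σ v
  | .const c => .const c
  | .add e d => .add (e.subst σ) (d.subst σ)
  | .mul e d => .mul (e.subst σ) (d.subst σ)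
  | .app h es => .app h fun i => (es i).subst σ
  | .diff e => .diff e

/-- A differential `(e)'` refers to all variables of `e` and their differential variables, so none
of them may be replaced. -/
def Term.Adm (σ : Var → Term S) : Term S → Prop
  | .var _ => True
  | .const _ => True
  | .add e d => e.Adm σ ∧ d.Adm σ
  | .mul e d => e.Adm σ ∧ d.Adm σ
  | .app _ es => ∀ i, (es i).Adm σ
  | .diff e => ∀ v ∈ (Term.diff e).fv, σ v = .var v

def SAFormula.subst (σ : Var → Term S) : SAFormula S → SAFormula S
  | .cmp c e d => .cmp c (e.subst σ) (d.subst σ)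
  | .and P Q => .and (P.subst σ) (Q.subst σ)
  | .or P Q => .or (P.subst σ) (Q.subst σ)
  | .not P => .not (P.subst σ)

def SAFormula.Adm (σ : Var → Term S) : SAFormula S → Prop
  | .cmp _ e d => e.Adm σ ∧ d.Adm σ
  | .and P Q => P.Adm σ ∧ Q.Adm σ
  | .or P Q => P.Adm σ ∧ Q.Adm σ
  | .not P => P.Adm σ

def Program.subst (σ : Var → Term S) : Program S → Program S
  | .assign v e => .assign v (e.subst σ)
  | .ode E Q => .ode (E.map fun p => (p.1, p.2.subst (reset σ E.bv))) (Q.subst (reset σ E.bv))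

/-- In a differential equation the evolving variables are both read and written, so they may not be
replaced; parameters may only be replaced by differential-free terms that do not evolve. -/
def Program.Adm (σ : Var → Term S) : Program S → Prop
  | .assign _ e => e.Adm σ
  | .ode E Q =>
      (∀ n ∈ E.names, σ (.base n) = .var (.base n)) ∧
      (∀ p ∈ E, p.2.Adm (reset σ E.bv)) ∧ Q.Adm (reset σ E.bv) ∧
      ∀ w ∈ E.rhsFv ∪ Q.fv, w ∉ E.bv → (σ w).DiffFree ∧ Disjoint (σ w).fv E.bv

def Formula.subst (σ : Var → Term S) : Formula S → Formula S
  | .cmp c e d => .cmp c (e.subst σ) (d.subst σ)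
  | .and φ ψ => .and (φ.subst σ) (ψ.subst σ)
  | .or φ ψ => .or (φ.subst σ) (ψ.subst σ)
  | .not φ => .not (φ.subst σ)
  | .all v φ => .all v (φ.subst (reset σ {v}))
  | .ex v φ => .ex v (φ.subst (reset σ {v}))
  | .box α φ => .box (α.subst σ) (φ.subst (reset σ α.bv))
  | .dia α φ => .dia (α.subst σ) (φ.subst (reset σ α.bv))

def Formula.Adm (σ : Var → Term S) : Formula S → Prop
  | .cmp _ e d => e.Adm σ ∧ d.Adm σ
  | .and φ ψ => φ.Adm σ ∧ ψ.Adm σ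
  | .or φ ψ => φ.Adm σ ∧ ψ.Adm σ
  | .not φ => φ.Adm σ
  | .all v φ => φ.Adm (reset σ {v}) ∧ ∀ w ∈ φ.fv, w ≠ v → v ∉ (σ w).fv
  | .ex v φ => φ.Adm (reset σ {v}) ∧ ∀ w ∈ φ.fv, w ≠ v → v ∉ (σ w).fv
  | .box α φ => α.Adm σ ∧ φ.Adm (reset σ α.bv) ∧
      ∀ w ∈ φ.fv, w ∉ α.bv → Disjoint (σ w).fv α.bv
  | .dia α φ => α.Adm σ ∧ φ.Adm (reset σ α.bv) ∧
      ∀ w ∈ φ.fv, w ∉ α.bv → Disjoint (σ w).fv α.bv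

end Syntactic

/-! ### Semantics -/

abbrev State := Var → ℝ

section Semantic

variable {S : Signature}

/-- The value of a term.  The value of `(e)'` is `∑_v ω(v') · ∂⟦e⟧/∂v`. -/
noncomputable def Term.eval : Term S → State → ℝ
  | .var v, ω => ω v
  | .const c, _ => (c : ℝ)
  | .add e d, ω => e.eval ω + d.eval ω
  | .mul e d, ω => e.eval ω * d.eval ω
  | .app h es, ω => S.interp h fun i => (es i).eval ω
  | .diff e, ω => ∑ v ∈ e.fv, ω v.prime * deriv (fun s => e.eval (Function.update ω v s)) (ω v)

def Cmp.holds : Cmp → ℝ → ℝ → Prop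
  | .eq, a, b => a = b
  | .ge, a, b => a ≥ b
  | .gt, a, b => a > b

def SAFormula.sat : SAFormula S → State → Prop
  | .cmp c e d, ω => c.holds (e.eval ω) (d.eval ω)
  | .and P Q, ω => P.sat ω ∧ Q.sat ω
  | .or P Q, ω => P.sat ω ∨ Q.sat ω
  | .not P, ω => ¬ P.sat ω

/-- `sol` is a solution of `x' = f(x) & Q` of duration `T`: along it the differential variables
have the values of the right-hand sides, `Q` holds, variables that do not evolve are constant, and,
if `T > 0`, the time derivative of `x_i` is the value of `x_i'`. -/
def ODE.IsSol (E : ODE S) (Q : SAFormula S) (T : ℝ) (sol : ℝ → State) : Prop :=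
  ∀ t ∈ Set.Icc 0 T,
    (∀ p ∈ E, sol t (Var.base p.1).prime = p.2.eval (sol t)) ∧ Q.sat (sol t) ∧
    (∀ v, v ∉ E.bv → sol t v = sol 0 v) ∧
    (0 < T → ∀ p ∈ E, HasDerivWithinAt (fun s => sol s (Var.base p.1))
      (sol t (Var.base p.1).prime) (Set.Icc 0 T) t)

/-- The transition relation of a program. -/
def Program.trans : Program S → State → State → Prop
  | .assign v e, ω, ν => ν = Function.update ω v (e.eval ω)
  | .ode E Q, ω, ν => ∃ T : ℝ, 0 ≤ T ∧ ∃ sol : ℝ → State,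
      (∀ v, (∀ n ∈ E.names, v ≠ (Var.base n).prime) → sol 0 v = ω v) ∧ sol T = ν ∧
      E.IsSol Q T sol

def Formula.sat : Formula S → State → Prop
  | .cmp c e d, ω => c.holds (e.eval ω) (d.eval ω)
  | .and φ ψ, ω => φ.sat ω ∧ ψ.sat ω
  | .or φ ψ, ω => φ.sat ω ∨ ψ.sat ω
  | .not φ, ω => ¬ φ.sat ω
  | .all v φ, ω => ∀ s : ℝ, φ.sat (Function.update ω v s)
  | .ex v φ, ω => ∃ s : ℝ, φ.sat (Function.update ω v s)
  | .box α φ, ω => ∀ ν, α.trans ω ν → φ.sat ν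
  | .dia α φ, ω => ∃ ν, α.trans ω ν ∧ φ.sat ν

def Formula.Valid (φ : Formula S) : Prop := ∀ ω, φ.sat ω

/-- The differential equation locally evolves `x`: its right-hand side has no zero. -/
def ODE.LocallyEvolves (E : ODE S) : Prop := ∀ ω : State, ∃ p ∈ E, p.2.eval ω ≠ 0

end Semantic

/-- A term language with smooth fixed function symbols `h` and syntactic partial derivatives: the
term `pd h i`, in the placeholder variables `y_0, …, y_{k-1}` (the ordinary variables with names
`0, …, k-1`), represents `∂h/∂y_i`. -/
structure TermLanguage extends Signature where
  smooth : ∀ h, ContDiff ℝ ((⊤ : ℕ∞) : WithTop ℕ∞) (interp h)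
  pd : (h : Fin r) → Fin (arity h) → Term toSignature
  pd_diffFree : ∀ h i, (pd h i).DiffFree
  pd_fv : ∀ h i, ∀ v ∈ (pd h i).fv, ∃ j : Fin (arity h), v = Var.base j
  pd_eval : ∀ h i (ω : State), (pd h i).eval ω =
    fderiv ℝ (interp h) (fun j => ω (Var.base j)) (Pi.single i 1)

section Calculus

variable (L : TermLanguage)

/-- `∂h/∂y_i (e_0, …, e_{k-1})` -/
def TermLanguage.pdApp (h : Fin L.r) (i : Fin (L.arity h))
    (es : Fin (L.arity h) → Term L.toSignature) : Term L.toSignature :=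
  (L.pd h i).subst fun v =>
    if hv : v.order = 0 ∧ v.name < L.arity h then es ⟨v.name, hv.2⟩ else .var v

/-- The syntactic partial derivative `∂e/∂x` of a differential-free term by the ordinary variable
with name `x`. -/
def partialDeriv (x : ℕ) : Term L.toSignature → Term L.toSignature
  | .var v => .const (if v = .base x then 1 else 0)
  | .const _ => .const 0
  | .add e d => .add (partialDeriv x e) (partialDeriv x d)
  | .mul e d => .add (.mul (partialDeriv x e) d) (.mul e (partialDeriv x d))
  | .app h es => .sum (List.ofFn fun i => .mul (L.pdApp h i es) (partialDeriv x (es i)))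
  | .diff _ => .const 0

/-- The Lie derivative `∑_i ∂e/∂x_i · f_i` of `e` along `x' = f(x)`. -/
def lie (E : ODE L.toSignature) (e : Term L.toSignature) : Term L.toSignature :=
  .sum (E.map fun p => .mul (partialDeriv L p.1 e) p.2)

/-- The `i`-th higher Lie derivative. -/
def lieN (E : ODE L.toSignature) (i : ℕ) (e : Term L.toSignature) : Term L.toSignature :=
  (lie L E)^[i] e

variable {L}

/-- `e = 0`, `e ≥ 0` and `e > 0` -/
def eqZ (e : Term L.toSignature) : SAFormula L.toSignature := .cmp .eq e (.const 0)
def geZ (e : Term L.toSignature) : SAFormula L.toSignature := .cmp .ge e (.const 0)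
def gtZ (e : Term L.toSignature) : SAFormula L.toSignature := .cmp .gt e (.const 0)

/-- The vectorial equation `x = y`, where `y` is given by the names of its components. -/
def vecEq (E : ODE L.toSignature) (ys : List ℕ) : SAFormula L.toSignature :=
  .bigAnd (List.zipWith (fun x y => .cmp .eq (.var (.base x)) (.var (.base y))) E.names ys)

/-- `ys` are the names of a vector of distinct ordinary variables, of the same dimension as `x`,
that do not occur in `x' = f(x)`. -/
def FreshFor (E : ODE L.toSignature) (ys : List ℕ) : Prop :=
  ys.length = E.length ∧ ys.Nodup ∧ ∀ y ∈ ys, y ∉ E.names ∧ Var.base y ∉ E.rhsFv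

/-- The local progress modality `⟨x' = f(x) & P ∨ x = y⟩ x ≠ y`. -/
def progress (E : ODE L.toSignature) (ys : List ℕ) (P : SAFormula L.toSignature) :
    Formula L.toSignature :=
  .dia (.ode E (.or P (vecEq E ys))) (.not (vecEq E ys).toFormula)

/-- `[x₁' := f₁] … [x_n' := f_n] φ` -/
def assignDiffs (E : ODE L.toSignature) (φ : Formula L.toSignature) : Formula L.toSignature :=
  E.foldr (fun p ψ => .box (.assign (Var.base p.1).prime p.2) ψ) φ

/-- The sequent calculus.  `Derives T Γ φ` says that the sequent `Γ ⊢ φ` is derivable from the base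
axioms and proof rules together with the formulas in `T` as further axioms. -/
inductive Derives (T : Set (Formula L.toSignature)) :
    List (Formula L.toSignature) → Formula L.toSignature → Prop
  -- further axioms
  | ax {Γ φ} : φ ∈ T → Derives T Γ φ
  -- structural and propositional rules
  | id {Γ φ} : φ ∈ Γ → Derives T Γ φ
  | weaken {Γ Δ φ} : Γ ⊆ Δ → Derives T Γ φ → Derives T Δ φ
  | cut {Γ φ} (ψ) : Derives T Γ ψ → Derives T (ψ :: Γ) φ → Derives T Γ φ
  | notL {Γ φ} : Derives T Γ φ → Derives T (.not φ :: Γ) .ff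
  | notR {Γ φ} : Derives T (φ :: Γ) .ff → Derives T Γ (.not φ)
  | contra {Γ φ} : Derives T (.not φ :: Γ) .ff → Derives T Γ φ
  | andL {Γ φ₁ φ₂ ψ} : Derives T (φ₁ :: φ₂ :: Γ) ψ → Derives T (.and φ₁ φ₂ :: Γ) ψ
  | andR {Γ φ₁ φ₂} : Derives T Γ φ₁ → Derives T Γ φ₂ → Derives T Γ (.and φ₁ φ₂)
  | orL {Γ φ₁ φ₂ ψ} : Derives T (φ₁ :: Γ) ψ → Derives T (φ₂ :: Γ) ψ →
      Derives T (.or φ₁ φ₂ :: Γ) ψ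
  | orR₁ {Γ φ₁ φ₂} : Derives T Γ φ₁ → Derives T Γ (.or φ₁ φ₂)
  | orR₂ {Γ φ₁ φ₂} : Derives T Γ φ₂ → Derives T Γ (.or φ₁ φ₂)
  | impL {Γ φ₁ φ₂ ψ} : Derives T Γ φ₁ → Derives T (φ₂ :: Γ) ψ →
      Derives T (φ₁.imp φ₂ :: Γ) ψ
  | impR {Γ φ₁ φ₂} : Derives T (φ₁ :: Γ) φ₂ → Derives T Γ (φ₁.imp φ₂)
  -- quantifier rules
  | allL {Γ φ ψ v} (e) : φ.Adm (single v e) → Derives T (φ.subst (single v e) :: Γ) ψ →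
      Derives T (.all v φ :: Γ) ψ
  | allR {Γ φ v} (y : Var) : y ∉ (Formula.all v φ).fv → (∀ χ ∈ Γ, y ∉ χ.fv) →
      φ.Adm (single v (.var y)) → Derives T Γ (φ.subst (single v (.var y))) →
      Derives T Γ (.all v φ)
  | exL {Γ φ ψ v} (y : Var) : y ∉ (Formula.ex v φ).fv → (∀ χ ∈ Γ, y ∉ χ.fv) → y ∉ ψ.fv →
      φ.Adm (single v (.var y)) → Derives T (φ.subst (single v (.var y)) :: Γ) ψ →
      Derives T (.ex v φ :: Γ) ψ
  | exR {Γ φ v} (e) : φ.Adm (single v e) → Derives T Γ (φ.subst (single v e)) →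
      Derives T Γ (.ex v φ)
  -- rule for substitution instances of valid formulas of first-order real arithmetic
  | real {Γ} {φ : Formula L.toSignature} (σ : Var → Term L.toSignature) : φ.IsArith → φ.Valid → φ.Adm σ →
      Derives T Γ (φ.subst σ)
  -- duality, Kripke axiom, generalization, vacuity, assignment
  | diamond {Γ α φ} :
      Derives T Γ ((Formula.dia α φ).iff (.not (.box α (.not φ))))
  | K {Γ α φ ψ} :
      Derives T Γ ((Formula.box α (φ.imp ψ)).imp ((Formula.box α φ).imp (.box α ψ)))
  | G {Γ α φ} : Derives T [] φ → Derives T Γ (.box α φ)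
  | V {Γ} {α : Program L.toSignature} {φ : Formula L.toSignature} : Disjoint φ.fv α.bv → Derives T Γ (φ.imp (.box α φ))
  | assign {Γ v e φ} : φ.Adm (single v e) →
      Derives T Γ ((Formula.box (.assign v e) φ).iff (φ.subst (single v e)))
  -- differential axioms
  | diffConst {Γ c} : Derives T Γ (.cmp .eq (.diff (.const c)) (.const 0))
  | diffVar {Γ v} : Derives T Γ (.cmp .eq (.diff (.var v)) (.var v.prime))
  | diffAdd {Γ e d} : Derives T Γ (.cmp .eq (.diff (.add e d)) (.add (.diff e) (.diff d)))
  | diffMul {Γ e d} : Derives T Γ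
      (.cmp .eq (.diff (.mul e d)) (.add (.mul (.diff e) d) (.mul e (.diff d))))
  | diffApp {Γ h es} : Derives T Γ (.cmp .eq (.diff (.app h es))
      (.sum (List.ofFn fun i => .mul (L.pdApp h i es) (.diff (es i)))))
  -- differential equations: Barcan, weakening, skip, modus ponens, differential effect
  | barcan {Γ E Q φ v} : E.WF → Q.DiffFree → v ∉ E.bv ∪ E.rhsFv ∪ Q.fv →
      Derives T Γ ((Formula.dia (.ode E Q) (.ex v φ)).iff (.ex v (.dia (.ode E Q) φ)))
  | DW {Γ E Q} : E.WF → Q.DiffFree → Derives T Γ (.box (.ode E Q) Q.toFormula)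
  | DX {Γ E Q φ} : E.WF → Q.DiffFree → (∀ n ∈ E.names, (Var.base n).prime ∉ φ.fv) →
      Derives T Γ ((Formula.box (.ode E Q) φ).iff
        (Q.toFormula.imp (.and φ (.box (.ode E Q) φ))))
  | DMP {Γ E Q R φ} : E.WF → Q.DiffFree → R.DiffFree →
      Derives T Γ ((Formula.box (.ode E Q) (Q.toFormula.imp R.toFormula)).imp
        ((Formula.box (.ode E R) φ).imp (.box (.ode E Q) φ)))
  | DE {Γ E Q φ} : E.WF → Q.DiffFree →
      Derives T Γ ((Formula.box (.ode E Q) φ).iff (.box (.ode E Q) (assignDiffs E φ)))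
  -- differential invariants; variables of `e` that do not evolve are constants, so their
  -- differential variables have to be assumed to be zero
  | DIeq {Γ E Q e} : E.WF → Q.DiffFree → e.DiffFree →
      (∀ z, Var.base z ∈ e.fv → z ∉ E.names →
        Formula.cmp .eq (.var (Var.base z).prime) (.const 0) ∈ Γ) →
      Derives T Γ ((Formula.box (.ode E Q) (.cmp .eq (.diff e) (.const 0))).imp
        ((Formula.box (.ode E Q) (.cmp .eq e (.const 0))).iff
          (Q.toFormula.imp (.cmp .eq e (.const 0)))))
  | DIge {Γ E Q e} (c : Cmp) : c = .ge ∨ c = .gt → E.WF → Q.DiffFree → e.DiffFree →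
      (∀ z, Var.base z ∈ e.fv → z ∉ E.names →
        Formula.cmp .eq (.var (Var.base z).prime) (.const 0) ∈ Γ) →
      Derives T Γ ((Formula.box (.ode E Q) (.cmp .ge (.diff e) (.const 0))).imp
        ((Formula.box (.ode E Q) (.cmp c e (.const 0))).iff
          (Q.toFormula.imp (.cmp c e (.const 0)))))
  -- differential cuts
  | DC {Γ E Q R φ} : E.WF → Q.DiffFree → R.DiffFree →
      Derives T Γ ((Formula.box (.ode E Q) R.toFormula).imp
        ((Formula.box (.ode E Q) φ).iff (.box (.ode E (.and Q R)) φ)))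
  -- differential ghosts `y' = a y + b` for fresh `y`, with either quantifier
  | DG {Γ E Q φ} (y : ℕ) (a b) : E.WF → Q.DiffFree → a.DiffFree → b.DiffFree →
      Var.base y ∉ E.bv ∪ E.rhsFv ∪ Q.fv ∪ φ.fv ∪ a.fv ∪ b.fv → (Var.base y).prime ∉ φ.fv →
      Derives T Γ ((Formula.box (.ode E Q) φ).iff
        (.ex (.base y) (.box (.ode (E ++ [(y, .add (.mul a (.var (.base y))) b)]) Q) φ)))
  | DGall {Γ E Q φ} (y : ℕ) (a b) : E.WF → Q.DiffFree → a.DiffFree → b.DiffFree →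
      Var.base y ∉ E.bv ∪ E.rhsFv ∪ Q.fv ∪ φ.fv ∪ a.fv ∪ b.fv → (Var.base y).prime ∉ φ.fv →
      Derives T Γ ((Formula.box (.ode E Q) φ).iff
        (.all (.base y) (.box (.ode (E ++ [(y, .add (.mul a (.var (.base y))) b)]) Q) φ)))

variable (L)

/-- All instances of the continuous existence axiom
`x = y → (⟨x' = f(x) & e > 0⟩ x ≠ y ↔ e > 0)`, where `x' = f(x)` locally evolves `x` and `y` is
fresh. -/
def contAxioms : Set (Formula L.toSignature) :=
  {φ | ∃ (E : ODE L.toSignature) (e : Term L.toSignature) (ys : List ℕ),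
    E.WF ∧ E.LocallyEvolves ∧ e.DiffFree ∧ FreshFor E ys ∧ (∀ y ∈ ys, Var.base y ∉ e.fv) ∧
    φ = (vecEq E ys).toFormula.imp
      ((Formula.dia (.ode E (gtZ e)) (.not (vecEq E ys).toFormula)).iff (gtZ e).toFormula)}

/-- All instances of the uniqueness axiom
`⟨x' = f(x) & Q₁ ∧ Q₂⟩ φ ↔ ⟨x' = f(x) & Q₁⟩ φ ∧ ⟨x' = f(x) & Q₂⟩ φ`. -/
def uniqAxioms : Set (Formula L.toSignature) :=
  {φ | ∃ (E : ODE L.toSignature) (Q₁ Q₂ : SAFormula L.toSignature) (ψ : Formula L.toSignature),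
    E.WF ∧ Q₁.DiffFree ∧ Q₂.DiffFree ∧
    φ = (Formula.dia (.ode E (.and Q₁ Q₂)) ψ).iff
      (.and (.dia (.ode E Q₁) ψ) (.dia (.ode E Q₂) ψ))}

variable {L}

/-- `N ≥ 1` is a rank of `e` along `x' = f(x)`: the differential radical identity
`e^(N) = ∑_{i<N} g_i e^(i)` for the higher Lie derivatives is derivable for some cofactors `g_i`. -/
def IsRank (T : Set (Formula L.toSignature)) (E : ODE L.toSignature) (e : Term L.toSignature)
    (N : ℕ) : Prop :=
  1 ≤ N ∧ ∃ g : ℕ → Term L.toSignature, (∀ i < N, (g i).DiffFree) ∧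
    Derives T [] (.cmp .eq (lieN L E N e)
      (.sum ((List.range N).map fun i => .mul (g i) (lieN L E i e))))

variable (L) in
/-- Every term has a derivable differential radical identity along every differential equation. -/
def HasDiffRadicals (T : Set (Formula L.toSignature)) : Prop :=
  ∀ (E : ODE L.toSignature) (e : Term L.toSignature), E.WF → e.DiffFree → ∃ N, IsRank T E e N

/-! ### Progress formulas -/

/-- The differential radical formula: `e^(i) = 0` for all `i < N`. -/
def progEq (E : ODE L.toSignature) (e : Term L.toSignature) (N : ℕ) : SAFormula L.toSignature :=
  .bigAnd ((List.range N).map fun i => eqZ (lieN L E i e))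

/-- `e = 0 ∧ e^(1) = 0 ∧ … ∧ e^(k-1) = 0 → P`, which for `k = 0` is just `P`. -/
def guarded (E : ODE L.toSignature) (e : Term L.toSignature) :
    ℕ → SAFormula L.toSignature → SAFormula L.toSignature
  | 0, P => P
  | k + 1, P => (progEq E e (k + 1)).imp P

/-- The progress formula of `e > 0`, for `e` of rank `N ≥ 1`: the first `N - 1` conjuncts
`e = 0 ∧ … ∧ e^(k-1) = 0 → e^(k) ≥ 0`, and the last one with `e^(N-1) > 0`. -/
def progGt (E : ODE L.toSignature) (e : Term L.toSignature) (N : ℕ) : SAFormula L.toSignature :=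
  .bigAnd ((List.range (N - 1)).map (fun k => guarded E e k (geZ (lieN L E k e))) ++
    [guarded E e (N - 1) (gtZ (lieN L E (N - 1) e))])

/-- The progress formula of `e ≥ 0`, for `e` of rank `N ≥ 1`. -/
def progGe (E : ODE L.toSignature) (e : Term L.toSignature) (N : ℕ) : SAFormula L.toSignature :=
  .or (progGt E e N) (progEq E e N)

variable (L) in
/-- A normal form `⋁_i (⋀_j e_ij ≥ 0 ∧ ⋀_j d_ij > 0)`, as the list of the pairs of the lists of
the `e_ij` and of the `d_ij`. -/
abbrev NormalForm := List (List (Term L.toSignature) × List (Term L.toSignature))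

def NormalForm.toSA (D : NormalForm L) : SAFormula L.toSignature :=
  .bigOr (D.map fun p => .and (.bigAnd (p.1.map geZ)) (.bigAnd (p.2.map gtZ)))

/-- The semianalytic progress formula of a normal form whose terms `e` have the ranks `ρ e`. -/
def NormalForm.prog (E : ODE L.toSignature) (ρ : Term L.toSignature → ℕ) (D : NormalForm L) :
    SAFormula L.toSignature :=
  .bigOr (D.map fun p =>
    .and (.bigAnd (p.1.map fun e => progGe E e (ρ e))) (.bigAnd (p.2.map fun e => progGt E e (ρ e))))

/-- `F` is a semianalytic progress formula of `P` along `x' = f(x)`: it is the progress formula of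
some normal form that is provably equivalent to `P`, with some ranks of its terms. -/
def IsProgressFormula (T : Set (Formula L.toSignature)) (E : ODE L.toSignature)
    (P F : SAFormula L.toSignature) : Prop :=
  ∃ (D : NormalForm L) (ρ : Term L.toSignature → ℕ),
    (∀ p ∈ D, ∀ e ∈ p.1 ++ p.2, e.DiffFree ∧ IsRank T E e (ρ e)) ∧
    Derives T [] (P.toFormula.iff D.toSA.toFormula) ∧ F = D.prog E ρ

end Calculus

end DL

-- At a point, local progress is decided by the first Lie derivative of `e` that does not vanish,
-- and the differential radical identity says that only the first `N` of them matter. Hence, at `x =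
-- y`, one of three cases occurs (`Initial.trichotomy`): all `e^(i)` with `i < N` vanish and `e = 0`
-- persists, or the first nonzero one is positive and the flow enters `e > 0`, or it is negative and
-- the flow enters `-e > 0`.
--
-- In the first case `s = ∑ (e^(i))²` satisfies `s' ≤ c s` for some cofactor `c`, so `s ≤ 0` is
-- invariant by a Darboux argument with two ghosts (`Derives.darboux`, `MaxCon.radical_invariant`).
-- In the other two cases (`Initial.progress_of_lie`) time is replaced by `r = |x - y|²`. Cont and
-- Uniq provide a run leaving `y` inside a domain where `e^(k) > r` and `(k + 1) r' < 1`;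
-- integrating `k` times with differential invariants gives `e ≥ r^(k+1)`, which is positive as soon
-- as `x ≠ y`.
--
-- So each atom `e > 0` or `e ≥ 0` is decided: its progress formula yields progress into the atom,
-- and the failure of that formula yields progress into the negated atom. Decisions of this kind
-- pass to conjunctions and disjunctions, hence to normal forms (`Initial.progress_normalForm`). By
-- Uniq, progress into `P` and into `¬P` exclude each other (`Initial.progress_not`), so the
-- decisions become equivalences (`Initial.progress_iff`). Completeness, duality and congruence are
-- read off from these.
--
-- Derivations are not written out. A sequent is derivable as soon as its conclusion lies in every
-- maximal consistent set containing its hypotheses (`Derives.of_maxCon`). Such a set acts like a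
-- truth assignment: connectives can be decomposed and cases distinguished inside it. Arithmetic
-- steps are checked pointwise over valuations of opaque atoms (`Derives.arith`), and fresh
-- variables supply the initial values `y` and the vanishing differential variables of parameters
-- (`Derives.of_zeroDiffs`).

namespace DL

/-! ### Arithmetic with opaque atoms -/

section Abstract

variable {S : Signature}

/-- The value of a term whose variables, applications and differentials are opaque atoms with
values `v`. -/
noncomputable def Term.aeval (v : Term S → ℝ) : Term S → ℝ
  | .var w => v (.var w)
  | .const c => (c : ℝ)
  | .add e d => e.aeval v + d.aeval v
  | .mul e d => e.aeval v * d.aeval v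
  | .app h es => v (.app h es)
  | .diff e => v (.diff e)

/-- Truth of a quantifier-free formula under a valuation of the atoms of its terms. -/
def SAFormula.asat (v : Term S → ℝ) : SAFormula S → Prop
  | .cmp c e d => c.holds (e.aeval v) (d.aeval v)
  | .and P Q => P.asat v ∧ Q.asat v
  | .or P Q => P.asat v ∨ Q.asat v
  | .not P => ¬ P.asat v

@[simp] theorem aeval_var (v : Term S → ℝ) (w) : (Term.var w).aeval v = v (.var w) := rfl
@[simp] theorem aeval_const (v : Term S → ℝ) (c) : (Term.const c : Term S).aeval v = (c : ℝ) := rfl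
@[simp] theorem aeval_add (v : Term S → ℝ) (e d) :
    (Term.add e d).aeval v = e.aeval v + d.aeval v := rfl
@[simp] theorem aeval_mul (v : Term S → ℝ) (e d) :
    (Term.mul e d).aeval v = e.aeval v * d.aeval v := rfl

theorem aeval_sum (v : Term S → ℝ) (l : List (Term S)) :
    (Term.sum l).aeval v = (l.map (Term.aeval v)).sum := by
  induction l with
  | nil => simp [Term.sum]
  | cons e l ih =>
    cases l with
    | nil => simp [Term.sum]
    | cons d l => simp only [Term.sum, aeval_add, ih, List.map_cons, List.sum_cons]

@[simp] theorem asat_eq (v : Term S → ℝ) (e d) :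
    (SAFormula.cmp .eq e d).asat v ↔ e.aeval v = d.aeval v := Iff.rfl
@[simp] theorem asat_ge (v : Term S → ℝ) (e d) :
    (SAFormula.cmp .ge e d).asat v ↔ d.aeval v ≤ e.aeval v := Iff.rfl
@[simp] theorem asat_gt (v : Term S → ℝ) (e d) :
    (SAFormula.cmp .gt e d).asat v ↔ d.aeval v < e.aeval v := Iff.rfl
@[simp] theorem asat_and (v : Term S → ℝ) (P Q) :
    (SAFormula.and P Q).asat v ↔ P.asat v ∧ Q.asat v := Iff.rfl
@[simp] theorem asat_or (v : Term S → ℝ) (P Q) :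
    (SAFormula.or P Q).asat v ↔ P.asat v ∨ Q.asat v := Iff.rfl
@[simp] theorem asat_not (v : Term S → ℝ) (P) :
    (SAFormula.not P).asat v ↔ ¬ P.asat v := Iff.rfl
@[simp] theorem asat_imp (v : Term S → ℝ) (P Q) :
    (SAFormula.imp P Q).asat v ↔ (P.asat v → Q.asat v) := by
  simp only [SAFormula.imp, asat_or, asat_not]; tauto
@[simp] theorem asat_tt (v : Term S → ℝ) : (SAFormula.tt : SAFormula S).asat v := rfl

/-- An encoding of terms by natural numbers. -/
def Term.code : Term S → ℕ
  | .var w => Nat.pair 0 (Nat.pair w.name w.order)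
  | .const c => Nat.pair 1 (Encodable.encode c)
  | .add e d => Nat.pair 2 (Nat.pair e.code d.code)
  | .mul e d => Nat.pair 3 (Nat.pair e.code d.code)
  | .app h es => Nat.pair 4 (Nat.pair h (Encodable.encode (List.ofFn fun i => (es i).code)))
  | .diff e => Nat.pair 5 e.code

/-- The rule `real` substitutes terms for variables, so every atom needs a variable name of its own;
injectivity lets `unpoly` recover the atom from the name. -/
theorem Term.code_injective : Function.Injective (Term.code (S := S)) := by
  intro e
  induction e with
  | var w =>
    intro d h
    cases d <;> simp [Term.code, Nat.pair_eq_pair] at h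
    rename_i w'
    cases w; cases w'; simp_all
  | const c =>
    intro d h
    cases d <;> simp [Term.code, Nat.pair_eq_pair] at h
    rw [h]
  | add e₁ e₂ ih₁ ih₂ =>
    intro d h
    cases d <;> simp [Term.code, Nat.pair_eq_pair] at h
    rw [ih₁ h.1, ih₂ h.2]
  | mul e₁ e₂ ih₁ ih₂ =>
    intro d h
    cases d <;> simp [Term.code, Nat.pair_eq_pair] at h
    rw [ih₁ h.1, ih₂ h.2]
  | app f es ih =>
    intro d h
    cases d <;> simp only [Term.code, Nat.pair_eq_pair] at h <;> try omega
    rename_i g ds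
    obtain ⟨-, h₁, h₂⟩ := h
    obtain rfl := Fin.ext h₁
    have := List.ofFn_injective (Encodable.encode_injective h₂)
    congr 1
    funext i
    exact ih i (congrFun this i)
  | diff e ih =>
    intro d h
    cases d <;> simp [Term.code, Nat.pair_eq_pair] at h
    rw [ih h]

/-- The polynomial term that results from replacing the atoms by variables. -/
def Term.poly : Term S → Term S
  | .var w => .var (.base (Term.var w : Term S).code)
  | .const c => .const c
  | .add e d => .add e.poly d.poly
  | .mul e d => .mul e.poly d.poly
  | .app h es => .var (.base (Term.app h es).code)
  | .diff e => .var (.base (Term.diff e).code)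

open Classical in
/-- The substitution that puts the atoms back. -/
noncomputable def unpoly (w : Var) : Term S :=
  if h : ∃ e : Term S, e.code = w.name then h.choose else .var w

theorem unpoly_code (e : Term S) : unpoly (.base e.code) = e := by
  have h : ∃ d : Term S, d.code = (Var.base e.code).name := ⟨e, rfl⟩
  rw [unpoly, dif_pos h]
  exact Term.code_injective h.choose_spec

theorem Term.poly_isPoly (e : Term S) : e.poly.IsPoly := by
  induction e <;> simp_all [Term.poly, Term.IsPoly]

theorem Term.poly_subst (e : Term S) : e.poly.subst unpoly = e := by
  induction e <;> simp_all [Term.poly, Term.subst, unpoly_code]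

theorem Term.poly_adm (σ : Var → Term S) (e : Term S) : e.poly.Adm σ := by
  induction e <;> simp_all [Term.poly, Term.Adm]

theorem Term.poly_eval (e : Term S) (ω : State) :
    e.poly.eval ω = e.aeval fun a => ω (.base a.code) := by
  induction e <;> simp_all [Term.poly, Term.eval, Term.aeval]

def SAFormula.poly : SAFormula S → SAFormula S
  | .cmp c e d => .cmp c e.poly d.poly
  | .and P Q => .and P.poly Q.poly
  | .or P Q => .or P.poly Q.poly
  | .not P => .not P.poly

theorem SAFormula.poly_isArith (P : SAFormula S) : P.poly.toFormula.IsArith := by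
  induction P <;> simp_all [SAFormula.poly, SAFormula.toFormula, Formula.IsArith, Term.poly_isPoly]

theorem SAFormula.poly_subst (P : SAFormula S) :
    P.poly.toFormula.subst unpoly = P.toFormula := by
  induction P <;> simp_all [SAFormula.poly, SAFormula.toFormula, Formula.subst, Term.poly_subst]

theorem SAFormula.poly_adm (σ : Var → Term S) (P : SAFormula S) : P.poly.toFormula.Adm σ := by
  induction P <;> simp_all [SAFormula.poly, SAFormula.toFormula, Formula.Adm, Term.poly_adm]

theorem SAFormula.poly_sat (P : SAFormula S) (ω : State) :
    P.poly.toFormula.sat ω ↔ P.asat fun a => ω (.base a.code) := by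
  induction P <;>
    simp_all [SAFormula.poly, SAFormula.toFormula, Formula.sat, Term.poly_eval, SAFormula.asat]

end Abstract

variable {L : TermLanguage} {T : Set (Formula L.toSignature)}

/-- Replacing the atoms by variables turns `P` into a valid formula of real arithmetic, and `unpoly`
restores `P`. Lie derivatives may thus be computed with as real numbers, for an arbitrary valuation
of the atoms. -/
theorem Derives.arith {Γ} {P : SAFormula L.toSignature} (h : ∀ v, P.asat v) :
    Derives T Γ P.toFormula := by
  rw [← P.poly_subst]
  exact .real _ P.poly_isArith (fun ω => (P.poly_sat ω).2 (h _)) (P.poly_adm _)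

/-! ### Maximal consistent sets -/

/-- `X` is consistent. -/
def Consistent (T X : Set (Formula L.toSignature)) : Prop :=
  ∀ l : List (Formula L.toSignature), (∀ φ ∈ l, φ ∈ X) → ¬ Derives T l .ff

/-- `M` is a maximal consistent set. -/
def MaxCon (T M : Set (Formula L.toSignature)) : Prop := Maximal (Consistent T) M

theorem exists_maxCon {X : Set (Formula L.toSignature)} (hX : Consistent T X) :
    ∃ M, MaxCon T M ∧ X ⊆ M := by
  obtain ⟨M, h₁, h₂⟩ := zorn_subset_nonempty {Y | Consistent T Y} (fun c hc hch hne => by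
    refine ⟨⋃₀ c, fun l hl hd => ?_, fun s hs => Set.subset_sUnion_of_mem hs⟩
    -- A refutation uses finitely many formulas, which all lie in a single member of the chain.
    have : ∃ Y ∈ c, ∀ φ ∈ l, φ ∈ Y := by
      clear hd
      induction l with
      | nil => obtain ⟨Y, hY⟩ := hne; exact ⟨Y, hY, by simp⟩
      | cons φ l ih =>
        obtain ⟨Y, hY, hlY⟩ := ih fun ψ hψ => hl ψ (by simp [hψ])
        obtain ⟨Z, hZ, hφZ⟩ := hl φ (by simp)
        rcases hch.total hY hZ with h | h
        · exact ⟨Z, hZ, by simpa using ⟨hφZ, fun ψ hψ => h (hlY ψ hψ)⟩⟩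
        · exact ⟨Y, hY, by simpa using ⟨h hφZ, hlY⟩⟩
    obtain ⟨Y, hY, hlY⟩ := this
    exact hc hY l hlY hd) X hX
  exact ⟨M, h₂, h₁⟩

namespace MaxCon

variable {M : Set (Formula L.toSignature)} (hM : MaxCon T M)
include hM

/-- By `cut`, adding a derivable consequence preserves consistency, so maximality already contains
it. -/
theorem closed {l : List (Formula L.toSignature)} {φ} (hl : ∀ ψ ∈ l, ψ ∈ M)
    (hd : Derives T l φ) : φ ∈ M := by
  have hc : Consistent T (insert φ M) := by
    classical
    intro l' hl' hd'
    refine hM.prop (l ++ l'.filter (· ≠ φ)) ?_ ?_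
    · intro ψ hψ
      rcases List.mem_append.1 hψ with h | h
      · exact hl _ h
      · have := List.mem_filter.1 h
        exact (hl' ψ this.1).resolve_left (by simpa using this.2)
    · refine .cut φ (.weaken (by simp) hd) (.weaken ?_ hd')
      intro ψ hψ
      by_cases h : ψ = φ
      · simp [h]
      · simp [h, hψ]
  exact hM.le_of_ge hc (Set.subset_insert _ _) (Set.mem_insert _ _)

theorem of_derives {φ} (hd : Derives T [] φ) : φ ∈ M := hM.closed (l := []) (by simp) hd

theorem mem_not {φ} : Formula.not φ ∈ M ↔ φ ∉ M := by
  constructor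
  · intro h h'
    exact hM.prop [.not φ, φ] (by simp [h, h']) (.notL (.id (by simp)))
  · intro h
    by_contra hn
    have hc : Consistent T (insert φ M) := by
      classical
      intro l' hl' hd'
      refine hn (hM.closed (l := l'.filter (· ≠ φ)) ?_ (.notR (.weaken ?_ hd')))
      · intro ψ hψ
        have := List.mem_filter.1 hψ
        exact (hl' ψ this.1).resolve_left (by simpa using this.2)
      · intro ψ hψ
        by_cases h : ψ = φ
        · simp [h]
        · simp [h, hψ]
    exact h (hM.le_of_ge hc (Set.subset_insert _ _) (Set.mem_insert _ _))

theorem mem_and {φ ψ} : Formula.and φ ψ ∈ M ↔ φ ∈ M ∧ ψ ∈ M := by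
  refine ⟨fun h => ⟨?_, ?_⟩, fun h => ?_⟩
  · exact hM.closed (l := [.and φ ψ]) (by simp [h]) (.andL (.id (by simp)))
  · exact hM.closed (l := [.and φ ψ]) (by simp [h]) (.andL (.id (by simp)))
  · exact hM.closed (l := [φ, ψ]) (by simp [h]) (.andR (.id (by simp)) (.id (by simp)))

theorem mem_or {φ ψ} : Formula.or φ ψ ∈ M ↔ φ ∈ M ∨ ψ ∈ M := by
  refine ⟨fun h => ?_, fun h => ?_⟩
  · by_contra! hn
    rw [← hM.mem_not, ← hM.mem_not] at hn
    exact hM.prop [.or φ ψ, .not φ, .not ψ] (by simp [h, hn])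
      (.orL (.weaken (Γ := .not φ :: [φ]) (by simp) (.notL (.id (by simp))))
        (.weaken (Γ := .not ψ :: [ψ]) (by simp) (.notL (.id (by simp)))))
  · rcases h with h | h
    · exact hM.closed (l := [φ]) (by simp [h]) (.orR₁ (.id (by simp)))
    · exact hM.closed (l := [ψ]) (by simp [h]) (.orR₂ (.id (by simp)))

theorem mem_imp {φ ψ} : Formula.imp φ ψ ∈ M ↔ (φ ∈ M → ψ ∈ M) := by
  rw [Formula.imp, hM.mem_or, hM.mem_not]; tauto

theorem mem_iff {φ ψ} : Formula.iff φ ψ ∈ M ↔ (φ ∈ M ↔ ψ ∈ M) := by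
  rw [Formula.iff, hM.mem_and, hM.mem_imp, hM.mem_imp]; tauto

end MaxCon

/-- Completeness for maximal consistent sets. -/
theorem exists_derives {X : Set (Formula L.toSignature)} {φ}
    (h : ∀ M, MaxCon T M → X ⊆ M → φ ∈ M) :
    ∃ l : List (Formula L.toSignature), (∀ ψ ∈ l, ψ ∈ X) ∧ Derives T l φ := by
  classical
  by_contra! hn
  have hc : Consistent T (insert (.not φ) X) := by
    intro l hl hd
    refine hn (l.filter (· ≠ .not φ)) ?_ (.contra (.weaken ?_ hd))
    · intro ψ hψ
      have := List.mem_filter.1 hψ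
      exact (hl ψ this.1).resolve_left (by simpa using this.2)
    · intro ψ hψ
      by_cases h : ψ = .not φ
      · simp [h]
      · simp [h, hψ]
  obtain ⟨M, hM, hXM⟩ := exists_maxCon hc
  exact (hM.mem_not.1 (hXM (Set.mem_insert _ _))) (h M hM fun ψ hψ => hXM (Set.mem_insert_of_mem _ hψ))

/-- This is the interface used from here on: to derive a sequent, reason inside an arbitrary maximal
consistent set that contains its hypotheses. -/
theorem Derives.of_maxCon {Γ φ} (h : ∀ M, MaxCon T M → (∀ ψ ∈ Γ, ψ ∈ M) → φ ∈ M) :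
    Derives T Γ φ := by
  obtain ⟨l, hl, hd⟩ := exists_derives (T := T) (X := {ψ | ψ ∈ Γ}) h
  exact .weaken hl hd

theorem Derives.of_maxCon_nil {φ} (h : ∀ M, MaxCon T M → φ ∈ M) : Derives T [] φ :=
  .of_maxCon fun M hM _ => h M hM

namespace MaxCon

variable {M : Set (Formula L.toSignature)} (hM : MaxCon T M)
include hM

/-- Arithmetical consequences. -/
theorem arith (H : List (SAFormula L.toSignature)) {P : SAFormula L.toSignature}
    (h : ∀ v, (∀ Q ∈ H, Q.asat v) → P.asat v) (hH : ∀ Q ∈ H, Q.toFormula ∈ M) :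
    P.toFormula ∈ M := by
  induction H generalizing P with
  | nil => exact hM.of_derives (.arith fun v => h v (by simp))
  | cons Q H ih =>
    have := ih (P := Q.imp P) (fun v hv => by simpa using fun hQ => h v (by simpa using ⟨hQ, hv⟩))
      fun R hR => hH R (by simp [hR])
    exact (hM.mem_imp.1 this) (hH Q (by simp))

theorem arith0 {P : SAFormula L.toSignature} (h : ∀ v, P.asat v) : P.toFormula ∈ M :=
  hM.of_derives (.arith h)

theorem arith1 {P Q : SAFormula L.toSignature} (h : ∀ v, Q.asat v → P.asat v)
    (hQ : Q.toFormula ∈ M) : P.toFormula ∈ M :=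
  hM.arith [Q] (by simpa using h) (by simpa using hQ)

theorem arith2 {P Q R : SAFormula L.toSignature} (h : ∀ v, Q.asat v → R.asat v → P.asat v)
    (hQ : Q.toFormula ∈ M) (hR : R.toFormula ∈ M) : P.toFormula ∈ M :=
  hM.arith [Q, R] (by simpa using h) (by simpa using ⟨hQ, hR⟩)

theorem arith3 {P Q R R' : SAFormula L.toSignature}
    (h : ∀ v, Q.asat v → R.asat v → R'.asat v → P.asat v)
    (hQ : Q.toFormula ∈ M) (hR : R.toFormula ∈ M) (hR' : R'.toFormula ∈ M) : P.toFormula ∈ M :=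
  hM.arith [Q, R, R'] (by simpa using h) (by simpa using ⟨hQ, hR, hR'⟩)

/-! Modal reasoning -/

theorem box_of {α : Program L.toSignature} {φ} (h : ∀ M', MaxCon T M' → φ ∈ M') :
    Formula.box α φ ∈ M :=
  hM.of_derives (.G (.of_maxCon_nil h))

/-- The implication has to hold in every maximal consistent set, not only in `M`: `G` admits no
context, so only theorems pass under a box. -/
theorem box_mono {α : Program L.toSignature} {φ ψ} (h : ∀ M', MaxCon T M' → φ ∈ M' → ψ ∈ M')
    (hφ : Formula.box α φ ∈ M) : Formula.box α ψ ∈ M := by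
  have h₁ : Formula.box α (φ.imp ψ) ∈ M := hM.box_of fun M' hM' => hM'.mem_imp.2 (h M' hM')
  exact hM.mem_imp.1 (hM.mem_imp.1 (hM.of_derives .K) h₁) hφ

theorem box_mono2 {α : Program L.toSignature} {φ φ' ψ}
    (h : ∀ M', MaxCon T M' → φ ∈ M' → φ' ∈ M' → ψ ∈ M')
    (hφ : Formula.box α φ ∈ M) (hφ' : Formula.box α φ' ∈ M) : Formula.box α ψ ∈ M := by
  have h₁ : Formula.box α (φ'.imp ψ) ∈ M :=
    hM.box_mono (fun M' hM' h' => hM'.mem_imp.2 (h M' hM' h')) hφ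
  exact hM.mem_imp.1 (hM.mem_imp.1 (hM.of_derives .K) h₁) hφ'

theorem box_forall {α : Program L.toSignature} (H : List (Formula L.toSignature)) {ψ}
    (h : ∀ M', MaxCon T M' → (∀ φ ∈ H, φ ∈ M') → ψ ∈ M')
    (hH : ∀ φ ∈ H, Formula.box α φ ∈ M) : Formula.box α ψ ∈ M := by
  induction H generalizing ψ with
  | nil => exact hM.box_of fun M' hM' => h M' hM' (by simp)
  | cons φ H ih =>
    have h₁ : Formula.box α (φ.imp ψ) ∈ M :=
      ih (fun M' hM' h' => hM'.mem_imp.2 fun hφ => h M' hM' (by simpa using ⟨hφ, h'⟩))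
        fun χ hχ => hH χ (by simp [hχ])
    exact hM.mem_imp.1 (hM.mem_imp.1 (hM.of_derives .K) h₁) (hH φ (by simp))

theorem mem_dia {α : Program L.toSignature} {φ} :
    Formula.dia α φ ∈ M ↔ Formula.box α (.not φ) ∉ M := by
  rw [← hM.mem_not]
  exact hM.mem_iff.1 (hM.of_derives .diamond)

/-- `[α](φ → ψ)` and `⟨α⟩φ` imply `⟨α⟩ψ`. -/
theorem dia_mono {α : Program L.toSignature} {φ ψ} (h : Formula.box α (φ.imp ψ) ∈ M)
    (hφ : Formula.dia α φ ∈ M) : Formula.dia α ψ ∈ M := by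
  rw [hM.mem_dia] at *
  contrapose! hφ
  exact hM.box_mono2 (fun M' hM' h₁ h₂ => by
    rw [hM'.mem_imp] at h₁; rw [hM'.mem_not] at *; tauto) h hφ

/-- Refinement of the domain constraint. -/
theorem dia_domain {E : ODE L.toSignature} {Q R : SAFormula L.toSignature} {φ}
    (hE : E.WF) (hQ : Q.DiffFree) (hR : R.DiffFree)
    (h : Formula.box (.ode E Q) R.toFormula ∈ M)
    (hφ : Formula.dia (.ode E Q) φ ∈ M) : Formula.dia (.ode E R) φ ∈ M := by
  rw [hM.mem_dia] at *
  contrapose! hφ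
  have h₁ : Formula.box (.ode E Q) (Q.toFormula.imp R.toFormula) ∈ M :=
    hM.box_mono (fun M' hM' h => hM'.mem_imp.2 fun _ => h) h
  exact hM.mem_imp.1 (hM.mem_imp.1 (hM.of_derives (.DMP hE hQ hR)) h₁) hφ

theorem domain {E : ODE L.toSignature} {Q : SAFormula L.toSignature}
    (hE : E.WF) (hQ : Q.DiffFree) : Formula.box (.ode E Q) Q.toFormula ∈ M :=
  hM.of_derives (.DW hE hQ)

theorem vacuous {α : Program L.toSignature} {φ : Formula L.toSignature} (h : Disjoint φ.fv α.bv)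
    (hφ : φ ∈ M) : Formula.box α φ ∈ M :=
  hM.mem_imp.1 (hM.of_derives (.V h)) hφ

end MaxCon

/-! ### Variables and substitutions -/

section Variables

variable {S : Signature}

theorem Var.eq_base {w : Var} (h : w.order = 0) : w = .base w.name := by
  cases w; simp_all [Var.base]

theorem Var.base_injective : Function.Injective Var.base := fun a b h => by
  simpa [Var.base] using h

theorem Term.DiffFree.order_eq_zero {e : Term S} (he : e.DiffFree) {w} (hw : w ∈ e.fv) :
    w.order = 0 := by
  induction e with
  | var v => obtain rfl := Finset.mem_singleton.1 hw; exact he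
  | const c => simp [Term.fv] at hw
  | add e d ih₁ ih₂ => rcases Finset.mem_union.1 hw with h | h; exacts [ih₁ he.1 h, ih₂ he.2 h]
  | mul e d ih₁ ih₂ => rcases Finset.mem_union.1 hw with h | h; exacts [ih₁ he.1 h, ih₂ he.2 h]
  | app h es ih =>
    obtain ⟨i, -, hi⟩ := Finset.mem_biUnion.1 hw
    exact ih i (he i) hi
  | diff e ih => exact he.elim

theorem SAFormula.DiffFree.order_eq_zero {P : SAFormula S} (hP : P.DiffFree) {w}
    (hw : w ∈ P.fv) : w.order = 0 := by
  induction P with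
  | cmp c e d =>
    rcases Finset.mem_union.1 hw with h | h
    exacts [hP.1.order_eq_zero h, hP.2.order_eq_zero h]
  | and P Q ih₁ ih₂ => rcases Finset.mem_union.1 hw with h | h; exacts [ih₁ hP.1 h, ih₂ hP.2 h]
  | or P Q ih₁ ih₂ => rcases Finset.mem_union.1 hw with h | h; exacts [ih₁ hP.1 h, ih₂ hP.2 h]
  | not P ih => exact ih hP hw

theorem SAFormula.fv_toFormula (P : SAFormula S) : P.toFormula.fv = P.fv := by
  induction P <;> simp_all [SAFormula.toFormula, SAFormula.fv, Formula.fv]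

theorem ODE.mem_rhsFv {E : ODE S} {w} : w ∈ E.rhsFv ↔ ∃ p ∈ E, w ∈ p.2.fv := by
  unfold ODE.rhsFv
  induction E <;> simp_all

theorem ODE.WF.order_eq_zero {E : ODE S} (hE : E.WF) {w} (hw : w ∈ E.rhsFv) : w.order = 0 := by
  obtain ⟨p, hp, h⟩ := ODE.mem_rhsFv.1 hw
  exact (hE.2 p hp).order_eq_zero h

theorem ODE.mem_bv {E : ODE S} {w} :
    w ∈ E.bv ↔ ∃ n ∈ E.names, w = .base n ∨ w = (Var.base n).prime := by
  simp only [ODE.bv, Finset.mem_union, List.mem_toFinset, List.mem_map]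
  constructor
  · rintro (⟨n, h, rfl⟩ | ⟨n, h, rfl⟩)
    exacts [⟨n, h, .inl rfl⟩, ⟨n, h, .inr rfl⟩]
  · rintro ⟨n, h, rfl | rfl⟩
    exacts [.inl ⟨n, h, rfl⟩, .inr ⟨n, h, rfl⟩]

theorem ODE.base_mem_bv {E : ODE S} {n} : Var.base n ∈ E.bv ↔ n ∈ E.names := by
  rw [ODE.mem_bv]
  simp [Var.base, Var.prime]

theorem ODE.prime_mem_bv {E : ODE S} {n} : (Var.base n).prime ∈ E.bv ↔ n ∈ E.names := by
  rw [ODE.mem_bv]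
  simp [Var.base, Var.prime]

theorem Term.DiffFree.adm {e : Term S} (he : e.DiffFree) (σ) : e.Adm σ := by
  induction e <;> simp_all [Term.DiffFree, Term.Adm]

theorem Term.subst_eq_self {e : Term S} {σ} (h : ∀ w ∈ e.fv, σ w = .var w) : e.subst σ = e := by
  induction e <;> simp_all [Term.fv, Term.subst]
  rename_i ih
  funext i
  exact ih i fun w hw => h w i hw

theorem single_self (v : Var) : (single v (.var v) : Var → Term S) = .var :=
  Function.update_eq_self _ _

theorem reset_var (B : Finset Var) : reset (.var : Var → Term S) B = .var := by
  funext w; simp [reset]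

theorem Term.subst_var (e : Term S) : e.subst .var = e := Term.subst_eq_self fun _ _ => rfl

theorem Term.subst_single {e t : Term S} {y} (h : y ∉ e.fv) : e.subst (single y t) = e :=
  Term.subst_eq_self fun w hw => Function.update_of_ne (fun h' => h (by rwa [← h'])) _ _

theorem Term.adm_var (e : Term S) : e.Adm .var := by
  induction e <;> simp_all [Term.Adm]

theorem SAFormula.subst_var (P : SAFormula S) : P.subst .var = P := by
  induction P <;> simp_all [SAFormula.subst, Term.subst_var]

theorem SAFormula.adm_var (P : SAFormula S) : P.Adm .var := by
  induction P <;> simp_all [SAFormula.Adm, Term.adm_var]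

theorem SAFormula.subst_var_toFormula (P : SAFormula S) :
    P.toFormula.subst .var = P.toFormula := by
  induction P <;> simp_all [SAFormula.toFormula, Formula.subst, Term.subst_var]

theorem SAFormula.adm_var_toFormula (P : SAFormula S) : P.toFormula.Adm .var := by
  induction P <;> simp_all [SAFormula.toFormula, Formula.Adm, Term.adm_var]

theorem subst_var_box (E : ODE S) (Q P : SAFormula S) :
    (Formula.box (.ode E Q) P.toFormula).subst .var = .box (.ode E Q) P.toFormula := by
  simp [Formula.subst, Program.subst, reset_var, SAFormula.subst_var,
    SAFormula.subst_var_toFormula, Term.subst_var]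

/-- `Program.Adm` asks even of the identity that parameters go to differential-free terms, hence the
assumptions on `E` and `Q`. The lemma serves to instantiate the quantifier of a ghost with its own
variable. -/
theorem adm_var_box {E : ODE S} {Q P : SAFormula S} (hE : E.WF) (hQ : Q.DiffFree) :
    (Formula.box (.ode E Q) P.toFormula).Adm .var := by
  simp only [Formula.Adm, Program.Adm, reset_var, SAFormula.adm_var, SAFormula.adm_var_toFormula,
    Term.adm_var, Term.fv, Finset.disjoint_singleton_left, Term.DiffFree, true_and, implies_true]
  refine ⟨fun w hw hb => ⟨?_, hb⟩, fun w _ hb => hb⟩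
  rcases Finset.mem_union.1 hw with h | h
  exacts [hE.order_eq_zero h, hQ.order_eq_zero h]

end Variables

/-! ### Introducing fresh variables -/

/-- A fresh variable may be assumed to have the value of any term. -/
theorem Derives.intro_eq {Γ φ} (y : Var) (t : Term L.toSignature) (hΓ : ∀ χ ∈ Γ, y ∉ χ.fv)
    (hφ : y ∉ φ.fv) (ht : y ∉ t.fv) (h : Derives T (.cmp .eq (.var y) t :: Γ) φ) :
    Derives T Γ φ := by
  -- Cut with `∃ y, y = t`, witnessed by `t`; being fresh, `y` is its own eigenvariable.
  refine .cut (.ex y (.cmp .eq (.var y) t)) (.exR t ?_ ?_) (.exL y ?_ hΓ hφ ?_ ?_)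
  · refine ⟨trivial, ?_⟩
    have key : ∀ e : Term L.toSignature, y ∉ e.fv → e.Adm (single y t) := by
      intro e he
      induction e <;> simp_all [Term.Adm, Term.fv]
      intro v hv
      refine Function.update_of_ne ?_ _ _
      rintro rfl
      rcases hv with hv | ⟨a, ha, hv⟩
      exacts [he.1 hv, he.2 a ha hv]
    exact key t ht
  · have h₁ : (single y t : Var → Term L.toSignature) y = t := Function.update_self _ _ _
    simp only [Formula.subst, Term.subst, Term.subst_single ht, h₁]
    exact .arith (P := .cmp .eq t t) fun v => rfl
  · simp [Formula.fv]
  · rw [single_self]; exact ⟨trivial, t.adm_var⟩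
  · rw [single_self]; simpa [Formula.subst, Term.subst_var, Term.subst] using h

theorem Derives.intro_eqs {Γ φ} (l : List (Var × Term L.toSignature)) (hl : (l.map Prod.fst).Nodup)
    (hΓ : ∀ p ∈ l, ∀ χ ∈ Γ, p.1 ∉ χ.fv) (hφ : ∀ p ∈ l, p.1 ∉ φ.fv)
    (ht : ∀ p ∈ l, ∀ q ∈ l, p.1 ∉ q.2.fv)
    (h : Derives T (l.map (fun p => .cmp .eq (.var p.1) p.2) ++ Γ) φ) : Derives T Γ φ := by
  induction l with
  | nil => exact h
  | cons p l ih =>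
    rw [List.map_cons, List.nodup_cons] at hl
    refine ih hl.2 (fun q hq => hΓ q (by simp [hq])) (fun q hq => hφ q (by simp [hq]))
      (fun q hq r hr => ht q (by simp [hq]) r (by simp [hr])) ?_
    refine .intro_eq p.1 p.2 ?_ (hφ p (by simp)) (ht p (by simp) p (by simp)) h
    intro χ hχ
    rcases List.mem_append.1 hχ with hχ | hχ
    · obtain ⟨q, hq, rfl⟩ := List.mem_map.1 hχ
      have h₁ : p.1 ≠ q.1 := fun h' => hl.1 (h' ▸ List.mem_map.2 ⟨q, hq, rfl⟩)
      simpa [Formula.fv, Term.fv, h₁] using ht p (by simp) q (by simp [hq])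
    · exact hΓ p (by simp) χ hχ

/-- All differential variables of ordinary variables are zero. -/
def ZeroDiffs (M : Set (Formula L.toSignature)) : Prop :=
  ∀ z, (eqZ (.var (Var.base z).prime) : SAFormula L.toSignature).toFormula ∈ M

/-- In formulas without differential variables, these may be assumed to be zero. -/
theorem Derives.of_zeroDiffs {Γ φ} (hΓ : ∀ χ ∈ Γ, ∀ w ∈ χ.fv, w.order = 0)
    (hφ : ∀ w ∈ φ.fv, w.order = 0)
    (h : ∀ M, MaxCon T M → ZeroDiffs M → (∀ χ ∈ Γ, χ ∈ M) → φ ∈ M) : Derives T Γ φ := by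
  classical
  -- `ZeroDiffs` is an infinite family of hypotheses. A derivation uses only finitely many of them,
  -- and `intro_eqs` discharges these because the sequent itself mentions no differential variable.
  obtain ⟨l, hl, hd⟩ := exists_derives (T := T)
    (X := {ψ | ψ ∈ Γ ∨ ∃ z, ψ = (eqZ (.var (Var.base z).prime) : SAFormula L.toSignature).toFormula})
    (φ := φ) (fun M hM hX => h M hM (fun z => hX (.inr ⟨z, rfl⟩)) (fun χ hχ => hX (.inl hχ)))
  have : ∃ zs : List ℕ, zs.Nodup ∧ ∀ ψ ∈ l, ψ ∈ Γ ∨ ∃ z ∈ zs,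
      ψ = (eqZ (.var (Var.base z).prime) : SAFormula L.toSignature).toFormula := by
    clear hd
    induction l with
    | nil => exact ⟨[], by simp⟩
    | cons ψ l ih =>
      obtain ⟨zs, hn, hz⟩ := ih fun ψ hψ => hl ψ (by simp [hψ])
      rcases hl ψ (by simp) with h' | ⟨z, h'⟩
      · refine ⟨zs, hn, ?_⟩
        simpa using ⟨.inl h', hz⟩
      · refine ⟨List.insert z zs, hn.insert, ?_⟩
        intro χ hχ
        rcases List.mem_cons.1 hχ with rfl | hχ
        · exact .inr ⟨z, List.mem_insert_self, h'⟩
        · exact (hz χ hχ).imp_right fun ⟨z', h₁, h₂⟩ => ⟨z', List.mem_insert_of_mem h₁, h₂⟩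
  obtain ⟨zs, hn, hz⟩ := this
  have order : ∀ z, (Var.base z).prime.order ≠ 0 := fun z => Nat.succ_ne_zero _
  refine .intro_eqs (zs.map fun z => ((Var.base z).prime, .const 0)) ?_ ?_ ?_ ?_ (.weaken ?_ hd)
  · rw [List.map_map]
    exact hn.map fun a b hab => by simpa [Var.base, Var.prime] using hab
  · intro p hp χ hχ hw
    obtain ⟨z, -, rfl⟩ := List.mem_map.1 hp
    exact order z (hΓ χ hχ _ hw)
  · intro p hp hw
    obtain ⟨z, -, rfl⟩ := List.mem_map.1 hp
    exact order z (hφ _ hw)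
  · intro p _ q hq
    obtain ⟨z, -, rfl⟩ := List.mem_map.1 hq
    simp [Term.fv]
  · intro ψ hψ
    rcases hz ψ hψ with h' | ⟨z, h₁, rfl⟩
    · simp [h']
    · exact List.mem_append_left _ (List.mem_map.2 ⟨_, List.mem_map.2 ⟨z, h₁, rfl⟩, rfl⟩)

/-! ### Lie derivatives -/

theorem aeval_lie (E : ODE L.toSignature) (v e) : (lie L E e).aeval v =
    (E.map fun p => (partialDeriv L p.1 e).aeval v * p.2.aeval v).sum := by
  simp [lie, aeval_sum, Function.comp_def]

@[simp] theorem aeval_lie_const (E : ODE L.toSignature) (v c) :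
    (lie L E (.const c)).aeval v = 0 := by
  simp [aeval_lie, partialDeriv]

@[simp] theorem aeval_lie_add (E : ODE L.toSignature) (v e d) :
    (lie L E (.add e d)).aeval v = (lie L E e).aeval v + (lie L E d).aeval v := by
  simp [aeval_lie, partialDeriv, add_mul, List.sum_map_add]

@[simp] theorem aeval_lie_mul (E : ODE L.toSignature) (v e d) : (lie L E (.mul e d)).aeval v =
    (lie L E e).aeval v * d.aeval v + e.aeval v * (lie L E d).aeval v := by
  simp only [aeval_lie, partialDeriv, aeval_add, aeval_mul, add_mul, List.sum_map_add,
    ← List.sum_map_mul_left, ← List.sum_map_mul_right]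
  congr 3 <;> · funext p; ring

theorem sum_map_finset_sum {α ι : Type*} [Fintype ι] (l : List α) (f : ι → α → ℝ) :
    (l.map fun p => ∑ i, f i p).sum = ∑ i, (l.map (f i)).sum := by
  induction l <;> simp_all [Finset.sum_add_distrib]

/-- Chain rule: the outer partial derivatives `L.pdApp h i es` do not depend on the variable of
differentiation, so they factor out of the sum over the equations. -/
theorem aeval_lie_app (E : ODE L.toSignature) (v h es) : (lie L E (.app h es)).aeval v =
    ∑ i, (L.pdApp h i es).aeval v * (lie L E (es i)).aeval v := by
  simp only [aeval_lie, partialDeriv, aeval_sum, List.map_ofFn, List.sum_ofFn, Function.comp,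
    aeval_mul, Finset.sum_mul, sum_map_finset_sum, ← List.sum_map_mul_left, mul_assoc]

theorem aeval_lie_var_of_mem {E : ODE L.toSignature} (hE : E.names.Nodup) {p} (hp : p ∈ E) (v) :
    (lie L E (.var (.base p.1))).aeval v = p.2.aeval v := by
  rw [aeval_lie]
  induction E with
  | nil => simp at hp
  | cons q E ih =>
    rw [ODE.names, List.map_cons, List.nodup_cons] at hE
    have key : ∀ n : ℕ, n ∉ E.map Prod.fst → (E.map fun p =>
        (partialDeriv L p.1 (.var (.base n))).aeval v * p.2.aeval v).sum = 0 := by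
      intro n hn
      refine List.sum_eq_zero fun x hx => ?_
      obtain ⟨r, hr, rfl⟩ := List.mem_map.1 hx
      have : n ≠ r.1 := fun h => hn (h ▸ List.mem_map.2 ⟨r, hr, rfl⟩)
      simp [partialDeriv, Var.base, this]
    rcases List.mem_cons.1 hp with rfl | hp
    · rw [List.map_cons, List.sum_cons, key _ hE.1]
      simp [partialDeriv]
    · have : p.1 ≠ q.1 := fun h => hE.1 (h ▸ List.mem_map.2 ⟨p, hp, rfl⟩)
      rw [List.map_cons, List.sum_cons, ih hE.2 hp]
      simp [partialDeriv, Var.base, this]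

theorem aeval_partialDeriv_of_notMem {x : ℕ} {e : Term L.toSignature} (he : Var.base x ∉ e.fv)
    (v) : (partialDeriv L x e).aeval v = 0 := by
  induction e with
  | var w =>
    have : w ≠ .base x := fun h => he (by simp [Term.fv, h])
    simp [partialDeriv, this]
  | const c => simp [partialDeriv]
  | add e d ih₁ ih₂ => simp_all [partialDeriv, Term.fv]
  | mul e d ih₁ ih₂ => simp_all [partialDeriv, Term.fv]
  | app h es ih =>
    simp only [Term.fv, Finset.mem_biUnion, Finset.mem_univ, true_and, not_exists] at he
    simp [partialDeriv, aeval_sum, List.map_ofFn, List.sum_ofFn, ih _ (he _)]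
  | diff e ih => simp [partialDeriv]

theorem aeval_lie_var_of_notMem {E : ODE L.toSignature} {n : ℕ} (hn : n ∉ E.names) (v) :
    (lie L E (.var (.base n))).aeval v = 0 := by
  rw [aeval_lie]
  refine List.sum_eq_zero fun x hx => ?_
  obtain ⟨p, hp, rfl⟩ := List.mem_map.1 hx
  rw [aeval_partialDeriv_of_notMem, zero_mul]
  have : p.1 ≠ n := fun h => hn (h ▸ List.mem_map.2 ⟨p, hp, rfl⟩)
  simpa [Term.fv, Var.base] using this

/-- Equations for variables that do not occur do not contribute to the Lie derivative. -/
theorem aeval_lie_append {E F : ODE L.toSignature} {e : Term L.toSignature}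
    (he : ∀ n ∈ F.names, Var.base n ∉ e.fv) (v) :
    (lie L (E ++ F) e).aeval v = (lie L E e).aeval v := by
  have : (F.map fun p => (partialDeriv L p.1 e).aeval v * p.2.aeval v).sum = 0 := by
    refine List.sum_eq_zero fun x hx => ?_
    obtain ⟨p, hp, rfl⟩ := List.mem_map.1 hx
    rw [aeval_partialDeriv_of_notMem (he _ (List.mem_map.2 ⟨p, hp, rfl⟩)), zero_mul]
  rw [aeval_lie, aeval_lie, List.map_append, List.sum_append, this, add_zero]

theorem Term.DiffFree.sum {l : List (Term L.toSignature)} (h : ∀ e ∈ l, e.DiffFree) :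
    (Term.sum l).DiffFree := by
  induction l with
  | nil => trivial
  | cons e l ih =>
    cases l with
    | nil => exact h e (by simp)
    | cons d l => exact ⟨h e (by simp), ih fun e he => h e (by simp [he])⟩

theorem Term.DiffFree.subst {S : Signature} {e : Term S} (he : e.DiffFree) {σ}
    (h : ∀ w ∈ e.fv, (σ w).DiffFree) : (e.subst σ).DiffFree := by
  induction e with
  | var w => exact h w (by simp [Term.fv])
  | const c => trivial
  | add e d ih₁ ih₂ =>
    exact ⟨ih₁ he.1 fun w hw => h w (by simp [Term.fv, hw]),
      ih₂ he.2 fun w hw => h w (by simp [Term.fv, hw])⟩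
  | mul e d ih₁ ih₂ =>
    exact ⟨ih₁ he.1 fun w hw => h w (by simp [Term.fv, hw]),
      ih₂ he.2 fun w hw => h w (by simp [Term.fv, hw])⟩
  | app f es ih =>
    exact fun i => ih i (he i) fun w hw => h w
      (Finset.mem_biUnion.2 ⟨i, Finset.mem_univ _, hw⟩)
  | diff e ih => exact he.elim

theorem Term.DiffFree.partialDeriv {e : Term L.toSignature} (he : e.DiffFree) (x) :
    (partialDeriv L x e).DiffFree := by
  induction e with
  | var w => trivial
  | const c => trivial
  | add e d ih₁ ih₂ => exact ⟨ih₁ he.1, ih₂ he.2⟩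
  | mul e d ih₁ ih₂ => exact ⟨⟨ih₁ he.1, he.2⟩, he.1, ih₂ he.2⟩
  | app f es ih =>
    refine Term.DiffFree.sum fun d hd => ?_
    obtain ⟨i, rfl⟩ := (List.mem_ofFn' _ _).1 hd
    refine ⟨(L.pd_diffFree f i).subst fun w hw => ?_, ih i (he i)⟩
    obtain ⟨j, rfl⟩ := L.pd_fv f i w hw
    rw [dif_pos ⟨rfl, j.2⟩]
    exact he _
  | diff e ih => trivial

theorem Term.DiffFree.lie {E : ODE L.toSignature} (hE : E.WF) {e : Term L.toSignature}
    (he : e.DiffFree) : (lie L E e).DiffFree := by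
  refine Term.DiffFree.sum fun d hd => ?_
  obtain ⟨p, hp, rfl⟩ := List.mem_map.1 hd
  exact ⟨he.partialDeriv _, hE.2 p hp⟩

theorem lieN_succ (E : ODE L.toSignature) (i e) : lieN L E (i + 1) e = lie L E (lieN L E i e) :=
  Function.iterate_succ_apply' _ _ _

theorem Term.DiffFree.lieN {E : ODE L.toSignature} (hE : E.WF) {e : Term L.toSignature}
    (he : e.DiffFree) (i) : (lieN L E i e).DiffFree := by
  induction i with
  | zero => exact he
  | succ i ih => rw [lieN_succ]; exact ih.lie hE

/-! ### Differentials along differential equations -/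

namespace MaxCon

variable {M : Set (Formula L.toSignature)} (hM : MaxCon T M)
include hM

theorem assignDiffs_vacuous {F : ODE L.toSignature} {φ : Formula L.toSignature}
    (h : ∀ n ∈ F.names, (Var.base n).prime ∉ φ.fv) (hφ : φ ∈ M) : assignDiffs F φ ∈ M := by
  induction F generalizing M with
  | nil => exact hφ
  | cons q F ih =>
    refine hM.box_mono (φ := φ)
      (fun M' hM' hφ' => ih hM' (fun n hn => h n (List.mem_cons_of_mem _ hn)) hφ')
      (hM.vacuous ?_ hφ)
    simpa [Program.bv] using h q.1 (by simp [ODE.names])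

/-- The assignments in front of `x_p' := f_p` are removed by generalization, this one makes the
equation reflexive, and the later ones write to differential variables that do not occur in it. -/
theorem assignDiffs_eq {F : ODE L.toSignature} (hF : F.WF) {p} (hp : p ∈ F) :
    assignDiffs F (.cmp .eq (.var (Var.base p.1).prime) p.2) ∈ M := by
  have order : ∀ n, (Var.base n).prime ∉ p.2.fv := fun n hn =>
    Nat.succ_ne_zero _ ((hF.2 p hp).order_eq_zero hn)
  have hp₂ := hF.2 p hp
  induction F generalizing M with
  | nil => simp at hp
  | cons q F ih =>
    obtain ⟨h₁, h₂⟩ := hF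
    rw [ODE.names, List.map_cons, List.nodup_cons] at h₁
    rcases List.mem_cons.1 hp with rfl | hp
    · refine hM.box_mono (φ := .cmp .eq (.var (Var.base p.1).prime) p.2)
        (fun M' hM' hφ' => hM'.assignDiffs_vacuous ?_ hφ') ?_
      · intro n hn
        have : n ≠ p.1 := fun h => h₁.1 (h ▸ hn)
        simp only [Formula.fv, Term.fv, Finset.mem_union, Finset.mem_singleton, order, or_false]
        simpa [Var.base, Var.prime] using this
      · refine (hM.mem_iff.1 (hM.of_derives (.assign ?_))).2 ?_
        · exact ⟨trivial, hp₂.adm _⟩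
        have h : single (Var.base p.1).prime p.2 (Var.base p.1).prime = p.2 :=
          Function.update_self _ _ _
        simp only [Formula.subst, Term.subst, Term.subst_single (order _), h]
        exact hM.arith0 (P := .cmp .eq p.2 p.2) fun v => rfl
    · exact hM.box_of fun M' hM' => ih hM' ⟨h₁.2, fun r hr => h₂ r (by simp [hr])⟩ hp

/-- Along the differential equation, `x_i'` has the value of the right-hand side. -/
theorem box_rhs {E : ODE L.toSignature} {Q : SAFormula L.toSignature} (hE : E.WF)
    (hQ : Q.DiffFree) {p} (hp : p ∈ E) :
    Formula.box (.ode E Q) (.cmp .eq (.var (Var.base p.1).prime) p.2) ∈ M :=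
  (hM.mem_iff.1 (hM.of_derives (.DE hE hQ))).2
    (hM.box_of fun _ hM' => hM'.assignDiffs_eq hE hp)

/-- Induction along the differential axioms. Evolving variables contribute their right-hand sides;
for a parameter `z` the Lie derivative is `0`, which matches the differential only because `z' = 0`
is assumed. -/
theorem diff_eq_lie {E : ODE L.toSignature} (hE : E.WF)
    (h : ∀ p ∈ E, Formula.cmp .eq (.var (Var.base p.1).prime) p.2 ∈ M) {e : Term L.toSignature}
    (he : e.DiffFree) (hz : ∀ z, Var.base z ∈ e.fv → z ∉ E.names →
      (eqZ (.var (Var.base z).prime) : SAFormula L.toSignature).toFormula ∈ M) :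
    (SAFormula.cmp .eq (.diff e) (lie L E e)).toFormula ∈ M := by
  induction e with
  | var w =>
    obtain ⟨n, rfl⟩ : ∃ n, w = .base n := ⟨_, Var.eq_base he⟩
    have h₁ := hM.of_derives (.diffVar (v := Var.base n))
    by_cases hn : n ∈ E.names
    · obtain ⟨p, hp, rfl⟩ := List.mem_map.1 hn
      refine hM.arith2 (Q := .cmp .eq (.diff (.var (Var.base p.1))) (.var (Var.base p.1).prime))
        (R := .cmp .eq (.var (Var.base p.1).prime) p.2) ?_ h₁ (h p hp)
      intro v h₁ h₂
      rw [asat_eq] at *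
      rw [aeval_lie_var_of_mem hE.1 hp, h₁, h₂]
    · refine hM.arith2 (Q := .cmp .eq (.diff (.var (Var.base n))) (.var (Var.base n).prime))
        (R := eqZ (.var (Var.base n).prime)) ?_ h₁ (hz n (by simp [Term.fv]) hn)
      intro v h₁ h₂
      rw [eqZ] at h₂
      rw [asat_eq] at *
      rw [aeval_lie_var_of_notMem hn, h₁, h₂]
      simp
  | const c =>
    refine hM.arith1 (Q := .cmp .eq (.diff (.const c)) (.const 0)) ?_ (hM.of_derives .diffConst)
    intro v h
    simpa using h
  | add e d ih₁ ih₂ =>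
    refine hM.arith3 (Q := .cmp .eq (.diff (.add e d)) (.add (.diff e) (.diff d))) ?_
      (hM.of_derives .diffAdd)
      (ih₁ he.1 fun z h => hz z (by simp [Term.fv, h]))
      (ih₂ he.2 fun z h => hz z (by simp [Term.fv, h]))
    intro v h₁ h₂ h₃
    simp only [asat_eq, aeval_add, aeval_lie_add] at *
    rw [h₁, h₂, h₃]
  | mul e d ih₁ ih₂ =>
    refine hM.arith3 (Q := .cmp .eq (.diff (.mul e d))
        (.add (.mul (.diff e) d) (.mul e (.diff d)))) ?_
      (hM.of_derives .diffMul)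
      (ih₁ he.1 fun z h => hz z (by simp [Term.fv, h]))
      (ih₂ he.2 fun z h => hz z (by simp [Term.fv, h]))
    intro v h₁ h₂ h₃
    simp only [asat_eq, aeval_add, aeval_mul, aeval_lie_mul] at *
    rw [h₁, h₂, h₃]
  | app f es ih =>
    refine hM.arith (.cmp .eq (.diff (.app f es))
      (.sum (List.ofFn fun i => .mul (L.pdApp f i es) (.diff (es i)))) ::
      List.ofFn fun i => .cmp .eq (.diff (es i)) (lie L E (es i))) ?_ ?_
    · intro v hv
      simp only [List.mem_cons, forall_eq_or_imp, List.forall_mem_ofFn_iff, asat_eq] at hv ⊢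
      rw [hv.1, aeval_lie_app, aeval_sum, List.map_ofFn, List.sum_ofFn]
      exact Finset.sum_congr rfl fun i _ => by simp [← hv.2 i]
    · simp only [List.mem_cons, forall_eq_or_imp, List.forall_mem_ofFn_iff]
      exact ⟨hM.of_derives .diffApp, fun i => ih i (he i) fun z h => hz z
        (Finset.mem_biUnion.2 ⟨i, Finset.mem_univ _, h⟩)⟩
  | diff e ih => exact he.elim

theorem box_diff_eq_lie {E : ODE L.toSignature} {Q : SAFormula L.toSignature} (hE : E.WF)
    (hQ : Q.DiffFree) {e : Term L.toSignature} (he : e.DiffFree) (hz : ZeroDiffs M) :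
    Formula.box (.ode E Q) (SAFormula.cmp .eq (.diff e) (lie L E e)).toFormula ∈ M := by
  classical
  -- The premises of `diff_eq_lie` are carried under the box: the right-hand sides by differential
  -- effect, and `z' = 0` for parameters by vacuity, since their differential variables do not
  -- change.
  refine hM.box_forall (E.map (fun p => .cmp .eq (.var (Var.base p.1).prime) p.2) ++
    (e.fv.toList.filter (·.name ∉ E.names)).map fun w =>
      (eqZ (.var (Var.base w.name).prime) : SAFormula L.toSignature).toFormula)
    (fun M' hM' h => hM'.diff_eq_lie hE (fun p hp => h _ ?_) he fun z hz hn => h _ ?_) ?_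
  · exact List.mem_append_left _ (List.mem_map.2 ⟨p, hp, rfl⟩)
  · exact List.mem_append_right _ (List.mem_map.2
      ⟨.base z, by simpa [hz] using (show (Var.base z).name ∉ E.names from hn), rfl⟩)
  · intro φ hφ
    rcases List.mem_append.1 hφ with hφ | hφ
    · obtain ⟨p, hp, rfl⟩ := List.mem_map.1 hφ
      exact hM.box_rhs hE hQ hp
    · obtain ⟨w, hw, rfl⟩ := List.mem_map.1 hφ
      refine hM.vacuous ?_ (hz w.name)
      simp only [List.mem_filter, decide_not, Bool.not_eq_eq_eq_not, Bool.not_true,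
        decide_eq_false_iff_not] at hw
      simpa [eqZ, SAFormula.toFormula, Formula.fv, Term.fv, Program.bv, ODE.prime_mem_bv] using hw.2

/-- Differential invariants `e ≥ 0`, with the Lie derivative. -/
theorem invariant_ge {E : ODE L.toSignature} {Q : SAFormula L.toSignature} (hE : E.WF)
    (hQ : Q.DiffFree) {e : Term L.toSignature} (he : e.DiffFree) (hz : ZeroDiffs M)
    (h : Formula.box (.ode E Q) (geZ (lie L E e)).toFormula ∈ M)
    (h₀ : (geZ e).toFormula ∈ M) : Formula.box (.ode E Q) (geZ e).toFormula ∈ M := by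
  -- The axiom wants the equations `z' = 0` literally in the context; they are listed for all
  -- variables of `e`, evolving or not.
  have hd := hM.closed (l := e.fv.toList.map fun w : Var =>
      (eqZ (.var (Var.base w.name).prime) : SAFormula L.toSignature).toFormula)
    (by simpa using fun (w : Var) _ => hz w.name)
    (.DIge .ge (.inl rfl) hE hQ he fun z hz _ =>
      List.mem_map.2 ⟨.base z, by simpa using hz, rfl⟩)
  refine (hM.mem_iff.1 (hM.mem_imp.1 hd ?_)).2 (hM.mem_imp.2 fun _ => h₀)
  refine hM.box_mono2 (fun M' hM' h₁ h₂ => hM'.arith2 (P := .cmp .ge (.diff e) (.const 0)) ?_ h₁ h₂)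
    h (hM.box_diff_eq_lie hE hQ he hz)
  intro v h₁ h₂
  rw [asat_eq] at h₂
  rw [geZ, asat_ge] at h₁
  rwa [asat_ge, h₂]

/-- Differential invariants `e = 0`, with the Lie derivative. -/
theorem invariant_eq {E : ODE L.toSignature} {Q : SAFormula L.toSignature} (hE : E.WF)
    (hQ : Q.DiffFree) {e : Term L.toSignature} (he : e.DiffFree) (hz : ZeroDiffs M)
    (h : Formula.box (.ode E Q) (eqZ (lie L E e)).toFormula ∈ M)
    (h₀ : (eqZ e).toFormula ∈ M) : Formula.box (.ode E Q) (eqZ e).toFormula ∈ M := by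
  have hd := hM.closed (l := e.fv.toList.map fun w : Var =>
      (eqZ (.var (Var.base w.name).prime) : SAFormula L.toSignature).toFormula)
    (by simpa using fun (w : Var) _ => hz w.name)
    (.DIeq hE hQ he fun z hz _ =>
      List.mem_map.2 ⟨.base z, by simpa using hz, rfl⟩)
  refine (hM.mem_iff.1 (hM.mem_imp.1 hd ?_)).2 (hM.mem_imp.2 fun _ => h₀)
  refine hM.box_mono2 (fun M' hM' h₁ h₂ => hM'.arith2 (P := .cmp .eq (.diff e) (.const 0)) ?_ h₁ h₂)
    h (hM.box_diff_eq_lie hE hQ he hz)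
  intro v h₁ h₂
  rw [asat_eq] at h₂
  rw [eqZ, asat_eq] at h₁
  rwa [asat_eq, h₂]

end MaxCon

/-! ### Differential radical invariants -/

def Term.neg {S : Signature} (e : Term S) : Term S := .mul (.const (-1)) e
def Term.sub {S : Signature} (e d : Term S) : Term S := .add e d.neg

@[simp] theorem aeval_neg {S : Signature} (v : Term S → ℝ) (e) :
    (Term.neg e).aeval v = -e.aeval v := by simp [Term.neg]
@[simp] theorem aeval_sub {S : Signature} (v : Term S → ℝ) (e d) :
    (Term.sub e d).aeval v = e.aeval v - d.aeval v := by simp [Term.sub, sub_eq_add_neg]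
@[simp] theorem aeval_lie_neg (E : ODE L.toSignature) (v e) :
    (lie L E e.neg).aeval v = -(lie L E e).aeval v := by simp [Term.neg]
@[simp] theorem aeval_lie_sub (E : ODE L.toSignature) (v e d) :
    (lie L E (e.sub d)).aeval v = (lie L E e).aeval v - (lie L E d).aeval v := by
  simp [Term.sub, sub_eq_add_neg]

theorem Term.fv_neg {S : Signature} (e : Term S) : e.neg.fv = e.fv := by simp [Term.neg, Term.fv]

theorem Term.DiffFree.neg {S : Signature} {e : Term S} (he : e.DiffFree) : e.neg.DiffFree :=
  ⟨trivial, he⟩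

theorem Term.DiffFree.sub {S : Signature} {e d : Term S} (he : e.DiffFree) (hd : d.DiffFree) :
    (e.sub d).DiffFree := ⟨he, hd.neg⟩

@[simp] theorem asat_eqZ (v : Term L.toSignature → ℝ) (e) :
    (eqZ e).asat v ↔ e.aeval v = 0 := by simp [eqZ]
@[simp] theorem asat_geZ (v : Term L.toSignature → ℝ) (e) :
    (geZ e).asat v ↔ 0 ≤ e.aeval v := by simp [geZ]
@[simp] theorem asat_gtZ (v : Term L.toSignature → ℝ) (e) :
    (gtZ e).asat v ↔ 0 < e.aeval v := by simp [gtZ]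

@[simp] theorem asat_bigAnd {S : Signature} (v : Term S → ℝ) (l : List (SAFormula S)) :
    (SAFormula.bigAnd l).asat v ↔ ∀ P ∈ l, P.asat v := by
  induction l with
  | nil => simp [SAFormula.bigAnd]
  | cons P l ih =>
    cases l with
    | nil => simp [SAFormula.bigAnd]
    | cons Q l => rw [SAFormula.bigAnd, asat_and, ih]; simp

@[simp] theorem asat_bigOr {S : Signature} (v : Term S → ℝ) (l : List (SAFormula S)) :
    (SAFormula.bigOr l).asat v ↔ ∃ P ∈ l, P.asat v := by
  induction l with
  | nil => simp [SAFormula.bigOr, SAFormula.ff]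
  | cons P l ih =>
    cases l with
    | nil => simp [SAFormula.bigOr]
    | cons Q l => rw [SAFormula.bigOr, asat_or, ih]; simp

theorem asat_progEq (E : ODE L.toSignature) (v e N) :
    (progEq E e N).asat v ↔ ∀ i < N, (lieN L E i e).aeval v = 0 := by
  simp [progEq]

theorem ODE.names_append {S : Signature} (E F : ODE S) :
    ODE.names (E ++ F) = E.names ++ F.names := List.map_append

theorem ODE.WF.concat {S : Signature} {E : ODE S} (hE : E.WF) {y : ℕ} {t : Term S}
    (hy : y ∉ E.names) (ht : t.DiffFree) : ODE.WF (E ++ [(y, t)]) := by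
  refine ⟨?_, ?_⟩
  · rw [ODE.names_append]
    refine List.nodup_append.2 ⟨hE.1, List.nodup_singleton y, ?_⟩
    intro a ha b hb
    obtain rfl := List.mem_singleton.1 hb
    exact fun h => hy (h ▸ ha)
  · intro p hp
    rcases List.mem_append.1 hp with hp | hp
    · exact hE.2 p hp
    · obtain rfl := List.mem_singleton.1 hp
      exact ht

-- Differential ghosts, Darboux inequalities and invariance of radicals

theorem exists_name_lt (B : Finset Var) : ∃ n, ∀ w ∈ B, w.name < n := by
  refine ⟨B.sup Var.name + 1, fun w hw => Nat.lt_succ_of_le (Finset.le_sup (f := Var.name) hw)⟩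

theorem fv_box_ode {E : ODE L.toSignature} {Q : SAFormula L.toSignature} {φ w}
    (hw : w ∈ (Formula.box (.ode E Q) φ).fv) :
    (∃ n ∈ E.names, w = .base n) ∨ w ∈ E.rhsFv ∨ w ∈ Q.fv ∨ w ∈ φ.fv := by
  simp only [Formula.fv, Program.fv, Finset.mem_union, Finset.mem_sdiff, List.mem_toFinset,
    List.mem_map] at hw
  rcases hw with ((⟨n, h, rfl⟩ | h) | h) | h
  exacts [.inl ⟨n, h, rfl⟩, .inr (.inl h), .inr (.inr (.inl h)), .inr (.inr (.inr h.1))]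

/-- A differential ghost with initial value `1`. -/
theorem Derives.ghost {Γ} {E : ODE L.toSignature} {Q P : SAFormula L.toSignature} (y : ℕ)
    {a b : Term L.toSignature} (hE : E.WF)
    (hQ : Q.DiffFree) (hP : P.DiffFree) (ha : a.DiffFree) (hb : b.DiffFree) (hy : y ∉ E.names)
    (hy' : Var.base y ∉ E.rhsFv ∪ Q.fv ∪ P.fv ∪ a.fv ∪ b.fv) (hΓ : ∀ χ ∈ Γ, Var.base y ∉ χ.fv)
    (h : Derives T (.cmp .eq (.var (.base y)) (.const 1) :: Γ)
      (.box (.ode (E ++ [(y, .add (.mul a (.var (.base y))) b)]) Q) P.toFormula)) :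
    Derives T Γ (.box (.ode E Q) P.toFormula) := by
  simp only [Finset.mem_union, not_or] at hy'
  refine .intro_eq (.base y) (.const 1) hΓ ?_ (by simp [Term.fv]) ?_
  · intro hw
    rcases fv_box_ode hw with ⟨n, hn, hw⟩ | hw | hw | hw
    · exact hy (Var.base_injective hw ▸ hn)
    · exact hy'.1.1.1.1 hw
    · exact hy'.1.1.1.2 hw
    · exact hy'.1.1.2 (P.fv_toFormula ▸ hw)
  · have hg : Derives T (.cmp .eq (.var (.base y)) (.const 1) :: Γ)
        (.ex (.base y) (.box (.ode (E ++ [(y, .add (.mul a (.var (.base y))) b)]) Q)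
          P.toFormula)) := by
      -- An evolving variable may not be replaced by `1`, so the witness is `y` itself, whose value
      -- `1` is already a hypothesis.
      refine .exR (.var (.base y)) ?_ ?_
      · rw [single_self]
        exact adm_var_box (hE.concat hy ⟨⟨ha, rfl⟩, hb⟩) hQ
      · rwa [single_self, subst_var_box]
    refine .of_maxCon fun M hM hH => ?_
    refine (hM.mem_iff.1 (hM.of_derives (.DG y a b hE hQ ha hb ?_ ?_))).2 (hM.closed hH hg)
    · simpa [ODE.base_mem_bv, SAFormula.fv_toFormula, hy, and_assoc] using hy'
    · rw [SAFormula.fv_toFormula]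
      intro hw
      exact Nat.succ_ne_zero _ (hP.order_eq_zero hw)

/-- Darboux inequalities: `s ≤ 0` is invariant if the Lie derivative of `s` is at most `c · s`. -/
theorem Derives.darboux {E : ODE L.toSignature} {Q : SAFormula L.toSignature}
    {s c : Term L.toSignature} (hE : E.WF) (hQ : Q.DiffFree) (hs : s.DiffFree) (hc : c.DiffFree)
    (h : ∀ M, MaxCon T M → (geZ ((Term.mul c s).sub (lie L E s))).toFormula ∈ M) :
    Derives T [(geZ s.neg).toFormula] (.box (.ode E Q) (geZ s.neg).toFormula) := by
  obtain ⟨y, hy⟩ := exists_name_lt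
    (s.fv ∪ c.fv ∪ E.rhsFv ∪ Q.fv ∪ (E.names.map Var.base).toFinset)
  have hyn : ∀ n, y ≤ n → Var.base n ∉ s.fv ∧ Var.base n ∉ c.fv ∧ Var.base n ∉ E.rhsFv ∧
      Var.base n ∉ Q.fv ∧ n ∉ E.names := by
    intro n hn
    have := fun h => not_lt.2 hn (hy (.base n) h)
    simp only [Finset.mem_union, List.mem_toFinset, List.mem_map] at this
    refine ⟨fun h => this (by simp [h]), fun h => this (by simp [h]), fun h => this (by simp [h]),
      fun h => this (by simp [h]), fun h => this (.inr ⟨n, h, rfl⟩)⟩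
  clear hy
  obtain ⟨hys, hyc, hyr, hyQ, hyE⟩ := hyn y le_rfl
  obtain ⟨hzs, hzc, hzr, hzQ, hzE⟩ := hyn (y + 1) (Nat.le_succ y)
  have hsfv : (geZ s.neg).fv = s.fv := by simp [geZ, SAFormula.fv, Term.fv_neg, Term.fv]
  have hsDF : (geZ s.neg).DiffFree := ⟨hs.neg, trivial⟩
  have hne : (Var.base (y + 1)) ≠ Var.base y := fun h => by simpa using Var.base_injective h
  -- Two ghosts `y' = -c y` and `z' = (c/2) z` start at `1`. Then `y z²` is constant, which keeps
  -- `y` positive, and `(s y)' = (s' - c s) y ≤ 0`.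
  refine .ghost y (a := c.neg) (b := .const 0) hE hQ hsDF hc.neg trivial hyE ?_ ?_ ?_
  · simp [hsfv, hys, hyc, hyr, hyQ, Term.fv_neg, Term.fv]
  · simp [SAFormula.fv_toFormula, hsfv, hys]
  have hE₁ : ODE.WF (E ++ [(y, .add (.mul c.neg (.var (.base y))) (.const 0))]) :=
    hE.concat hyE ⟨⟨hc.neg, rfl⟩, trivial⟩
  have hzE₁ : y + 1 ∉
      ODE.names (E ++ [(y, .add (.mul c.neg (.var (.base y))) (.const 0))]) := by
    rw [ODE.names_append]; simp [ODE.names]; simpa [ODE.names] using hzE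
  have hd₂ : (Term.mul (.const (1 / 2)) c).DiffFree := ⟨trivial, hc⟩
  refine .ghost (y + 1) (a := .mul (.const (1 / 2)) c) (b := .const 0) hE₁
    hQ hsDF hd₂ trivial hzE₁ ?_ ?_ ?_
  · simp only [Finset.mem_union, hsfv, hzs, hzQ, Term.fv, hzc, Finset.notMem_empty, or_false,
      ODE.mem_rhsFv, List.mem_append, List.mem_singleton, not_exists, not_and]
    rintro p (hp | rfl)
    · exact fun h => hzr (ODE.mem_rhsFv.2 ⟨p, hp, h⟩)
    · simpa [Term.fv, Term.fv_neg, hzc] using hne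
  · simpa [SAFormula.fv_toFormula, hsfv, hzs, Formula.fv, Term.fv] using hne
  have hE₂ := hE₁.concat (t := .add (.mul (.mul (.const (1 / 2)) c) (.var (.base (y + 1))))
    (.const 0)) hzE₁ ⟨⟨hd₂, rfl⟩, trivial⟩
  set t₁ : Term L.toSignature := .add (.mul c.neg (.var (.base y))) (.const 0) with ht₁
  set t₂ : Term L.toSignature :=
    .add (.mul (.mul (.const (1 / 2)) c) (.var (.base (y + 1)))) (.const 0) with ht₂
  refine .of_zeroDiffs ?_ ?_ ?_
  · intro χ hχ w hw
    simp only [List.mem_cons, List.not_mem_nil, or_false] at hχ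
    rcases hχ with rfl | rfl | rfl
    · obtain rfl : w = _ := by simpa [Formula.fv, Term.fv] using hw
      rfl
    · obtain rfl : w = _ := by simpa [Formula.fv, Term.fv] using hw
      rfl
    · exact hsDF.order_eq_zero (by rwa [SAFormula.fv_toFormula] at hw)
  · intro w hw
    rcases fv_box_ode hw with ⟨n, hn, rfl⟩ | hw | hw | hw
    · rfl
    · exact hE₂.order_eq_zero hw
    · exact hQ.order_eq_zero hw
    · exact hsDF.order_eq_zero (by rwa [SAFormula.fv_toFormula] at hw)
  intro M hM hZ hΓ
  simp only [List.mem_cons, List.not_mem_nil, or_false, forall_eq_or_imp, forall_eq] at hΓ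
  obtain ⟨hz1, hy1, hs0⟩ := hΓ
  have Ly : ∀ v, (lie L (E ++ [(y, t₁)] ++ [(y + 1, t₂)]) (.var (.base y))).aeval v =
      -(c.aeval v * v (.var (.base y))) := by
    intro v
    rw [aeval_lie_var_of_mem hE₂.1 (p := (y, t₁)) (by simp)]
    simp [ht₁]
  have Lz : ∀ v, (lie L (E ++ [(y, t₁)] ++ [(y + 1, t₂)]) (.var (.base (y + 1)))).aeval v =
      1 / 2 * c.aeval v * v (.var (.base (y + 1))) := by
    intro v
    rw [aeval_lie_var_of_mem hE₂.1 (p := (y + 1, t₂)) (by simp)]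
    simp [ht₂]
  have Ls : ∀ v, (lie L (E ++ [(y, t₁)] ++ [(y + 1, t₂)]) s).aeval v = (lie L E s).aeval v := by
    intro v
    rw [aeval_lie_append (by simpa [ODE.names] using hzs),
      aeval_lie_append (by simpa [ODE.names] using hys)]
  let Y : Term L.toSignature := .var (.base y)
  let Z : Term L.toSignature := .var (.base (y + 1))
  have inv₁ := hM.invariant_eq hE₂ hQ (e := (Term.mul Y (.mul Z Z)).sub (.const 1))
    (Term.DiffFree.sub ⟨rfl, rfl, rfl⟩ trivial) hZ
    (hM.box_of fun M' hM' => hM'.arith0 fun v => by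
      simp only [Y, Z, asat_eqZ, aeval_lie_sub, aeval_lie_mul, Ly, Lz, aeval_mul, aeval_var,
        aeval_lie_const]
      ring)
    (hM.arith2 (Q := .cmp .eq Z (.const 1)) (R := .cmp .eq Y (.const 1))
      (fun v h₁ h₂ => by simp_all [Y, Z]) hz1 hy1)
  have pos : ∀ y z : ℝ, y * (z * z) - 1 = 0 → 0 < y := fun y z h => by
    by_contra! hn
    nlinarith [mul_nonneg (neg_nonneg.2 hn) (mul_self_nonneg z)]
  have inv₂ := hM.invariant_ge hE₂ hQ (e := (Term.mul s Y).neg)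
    (Term.DiffFree.neg ⟨hs, rfl⟩) hZ
    (hM.box_mono (fun M' hM' h₁ => hM'.arith2 (fun v h₁ h₂ => by
      simp only [Y, Z, asat_eqZ, asat_geZ, aeval_lie_neg, aeval_lie_mul, Ly, Ls, aeval_mul,
        aeval_var, aeval_sub, aeval_const, Rat.cast_one] at *
      nlinarith [mul_nonneg (pos _ _ h₁).le h₂]) h₁ (h M' hM')) inv₁)
    (hM.arith2 (Q := geZ s.neg) (R := .cmp .eq Y (.const 1))
      (fun v h₁ h₂ => by simp_all [Y]) hs0 hy1)
  -- Since `y > 0`, the bound `s y ≤ 0` gives `s ≤ 0`.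
  refine hM.box_mono2 (fun M' hM' h₁ h₂ => hM'.arith2 (fun v h₁ h₂ => ?_) h₁ h₂) inv₁ inv₂
  simp only [Y, Z, asat_eqZ, asat_geZ, aeval_mul, aeval_var, aeval_sub, aeval_const, aeval_neg,
    Rat.cast_one] at *
  by_contra! hn
  nlinarith [pos _ _ h₁]

/-- Bound `2 a_i a_{i+1}` by `a_i² + a_{i+1}²`. The shifted sum of squares exceeds the original by
at most `a_N²`, which Cauchy–Schwarz bounds by `(∑ g_i²)(∑ a_i²)`. With `a_i = e^(i)` this is the
Darboux inequality for the radical. -/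
theorem sum_mul_succ_le (a g : ℕ → ℝ) (N : ℕ)
    (h : a N = ∑ i ∈ Finset.range N, g i * a i) :
    ∑ i ∈ Finset.range N, 2 * (a i * a (i + 1)) ≤
      (2 + ∑ i ∈ Finset.range N, g i * g i) * ∑ i ∈ Finset.range N, a i * a i := by
  have h₁ : ∑ i ∈ Finset.range N, 2 * (a i * a (i + 1)) ≤
      ∑ i ∈ Finset.range N, (a i * a i + a (i + 1) * a (i + 1)) :=
    Finset.sum_le_sum fun i _ => by nlinarith [sq_nonneg (a i - a (i + 1))]
  have h₂ := Finset.sum_range_succ (fun i => a i * a i) N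
  rw [Finset.sum_range_succ'] at h₂
  have h₃ := Finset.sum_mul_sq_le_sq_mul_sq (Finset.range N) g a
  rw [← h] at h₃
  simp only [sq] at h₃
  rw [Finset.sum_add_distrib] at h₁
  nlinarith [mul_self_nonneg (a 0)]

theorem sum_map_range (f : ℕ → ℝ) (N : ℕ) :
    ((List.range N).map f).sum = ∑ i ∈ Finset.range N, f i := by
  simp [Finset.sum, Multiset.range]

theorem aeval_sum_range {S : Signature} (v : Term S → ℝ) (f : ℕ → Term S) (N : ℕ) :
    (Term.sum ((List.range N).map f)).aeval v = ∑ i ∈ Finset.range N, (f i).aeval v := by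
  rw [aeval_sum, List.map_map]
  exact sum_map_range _ N

theorem aeval_lie_sum (E : ODE L.toSignature) (v) (l : List (Term L.toSignature)) :
    (lie L E (.sum l)).aeval v = (l.map fun d => (lie L E d).aeval v).sum := by
  induction l with
  | nil => simp [Term.sum]
  | cons e l ih =>
    cases l with
    | nil => simp [Term.sum]
    | cons d l => rw [Term.sum, aeval_lie_add, ih]; simp

theorem SAFormula.DiffFree.bigAnd {S : Signature} {l : List (SAFormula S)}
    (h : ∀ P ∈ l, P.DiffFree) : (SAFormula.bigAnd l).DiffFree := by
  induction l with
  | nil => exact ⟨trivial, trivial⟩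
  | cons P l ih =>
    cases l with
    | nil => exact h P (by simp)
    | cons Q l => exact ⟨h P (by simp), ih fun R hR => h R (by simp [hR])⟩

theorem SAFormula.DiffFree.bigOr {S : Signature} {l : List (SAFormula S)}
    (h : ∀ P ∈ l, P.DiffFree) : (SAFormula.bigOr l).DiffFree := by
  induction l with
  | nil => exact ⟨trivial, trivial⟩
  | cons P l ih =>
    cases l with
    | nil => exact h P (by simp)
    | cons Q l => exact ⟨h P (by simp), ih fun R hR => h R (by simp [hR])⟩

/-- Invariance of `e = 0 ∧ … ∧ e^(N-1) = 0`. -/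
theorem MaxCon.radical_invariant {M : Set (Formula L.toSignature)} (hM : MaxCon T M)
    {E : ODE L.toSignature} {Q : SAFormula L.toSignature} {e : Term L.toSignature} {N : ℕ}
    (hE : E.WF) (hQ : Q.DiffFree) (he : e.DiffFree) (hN : IsRank T E e N)
    (h₀ : (progEq E e N).toFormula ∈ M) :
    Formula.box (.ode E Q) (progEq E e N).toFormula ∈ M := by
  obtain ⟨-, g, hg, hd⟩ := hN
  -- The conjunction says exactly that the sum of squares `s` is at most `0`, and `sum_mul_succ_le`
  -- supplies the cofactor `c`.
  let s : Term L.toSignature :=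
    .sum ((List.range N).map fun i => .mul (lieN L E i e) (lieN L E i e))
  let c : Term L.toSignature :=
    .add (.const 2) (.sum ((List.range N).map fun i => .mul (g i) (g i)))
  have hs : s.DiffFree := Term.DiffFree.sum fun d hd => by
    obtain ⟨i, -, rfl⟩ := List.mem_map.1 hd
    exact ⟨he.lieN hE i, he.lieN hE i⟩
  have hc : c.DiffFree := ⟨trivial, Term.DiffFree.sum fun d hd => by
    obtain ⟨i, hi, rfl⟩ := List.mem_map.1 hd
    exact ⟨hg i (List.mem_range.1 hi), hg i (List.mem_range.1 hi)⟩⟩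
  have hv : ∀ v, s.aeval v = ∑ i ∈ Finset.range N,
      (lieN L E i e).aeval v * (lieN L E i e).aeval v := fun v => by
    simp [s, aeval_sum_range]
  have hLs : ∀ v, (lie L E s).aeval v = ∑ i ∈ Finset.range N,
      2 * ((lieN L E i e).aeval v * (lieN L E (i + 1) e).aeval v) := by
    intro v
    rw [aeval_lie_sum, List.map_map]
    refine (sum_map_range _ _).trans (Finset.sum_congr rfl fun i _ => ?_)
    rw [Function.comp_apply, aeval_lie_mul, lieN_succ]
    ring
  have hd' := Derives.darboux (T := T) (Q := Q) hE hQ hs hc fun M' hM' =>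
    hM'.arith1 (Q := .cmp .eq (lieN L E N e)
      (.sum ((List.range N).map fun i => .mul (g i) (lieN L E i e)))) (fun v h => by
      simp only [asat_eq, aeval_sum_range, aeval_mul] at h
      have := sum_mul_succ_le (fun i => (lieN L E i e).aeval v) (fun i => (g i).aeval v) N h
      simp only [asat_geZ, aeval_sub, aeval_mul, c, aeval_add, aeval_sum_range, hv, hLs]
      simpa using this) (hM'.of_derives hd)
  refine hM.box_mono (fun M' hM' => hM'.arith1 fun v h => ?_)
    (hM.closed (l := [(geZ s.neg).toFormula]) ?_ hd')
  · rw [asat_geZ, aeval_neg, hv] at h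
    rw [asat_progEq]
    intro i hi
    have h₁ := Finset.single_le_sum (f := fun i => (lieN L E i e).aeval v * (lieN L E i e).aeval v)
      (fun i _ => mul_self_nonneg _) (Finset.mem_range.2 hi)
    exact mul_self_eq_zero.1 (le_antisymm (by linarith) (mul_self_nonneg _))
  · simp only [List.mem_singleton, forall_eq]
    refine hM.arith1 (fun v h => ?_) h₀
    rw [asat_progEq] at h
    rw [asat_geZ, aeval_neg, hv, Finset.sum_eq_zero fun i hi => by
      rw [h i (Finset.mem_range.1 hi), zero_mul]]
    simp

/-! ### Vectorial equations -/

/-- `a = b` for vectors of ordinary variables, given by their names. -/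
def pairEq {S : Signature} (as bs : List ℕ) : SAFormula S :=
  .bigAnd (List.zipWith (fun x y => .cmp .eq (.var (.base x)) (.var (.base y))) as bs)

theorem asat_pairEq_zip {S : Signature} (v : Term S → ℝ) (as bs : List ℕ) :
    (pairEq as bs).asat v ↔
      ∀ q ∈ as.zip bs, v (.var (.base q.1)) = v (.var (.base q.2)) := by
  rw [pairEq, asat_bigAnd, ← List.map_uncurry_zip_eq_zipWith, List.forall_mem_map]
  rfl

theorem asat_pairEq {S : Signature} (v : Term S → ℝ) (as bs : List ℕ) :
    (pairEq as bs).asat v ↔ ∀ i, ∀ (h : i < as.length) (h' : i < bs.length),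
      v (.var (.base as[i])) = v (.var (.base bs[i])) := by
  rw [asat_pairEq_zip]
  constructor
  · intro h i hi hi'
    exact h (as[i], bs[i]) (List.mem_iff_getElem.2 ⟨i, by simp [hi, hi'], by simp⟩)
  · intro h q hq
    obtain ⟨i, hi, rfl⟩ := List.mem_iff_getElem.1 hq
    simp only [List.length_zip, lt_inf_iff] at hi
    simpa using h i hi.1 hi.2

theorem fv_bigAnd {S : Signature} {l : List (SAFormula S)} {w} (hw : w ∈ (SAFormula.bigAnd l).fv) :
    ∃ P ∈ l, w ∈ P.fv := by
  induction l with
  | nil => simp [SAFormula.bigAnd, SAFormula.tt, SAFormula.fv, Term.fv] at hw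
  | cons P l ih =>
    cases l with
    | nil => exact ⟨P, by simp, hw⟩
    | cons Q l =>
      rcases Finset.mem_union.1 hw with h | h
      · exact ⟨P, by simp, h⟩
      · obtain ⟨R, hR, h⟩ := ih h
        exact ⟨R, by simp [hR], h⟩

theorem fv_pairEq {S : Signature} {as bs : List ℕ} {w} (hw : w ∈ (pairEq as bs : SAFormula S).fv) :
    ∃ n, w = .base n ∧ (n ∈ as ∨ n ∈ bs) := by
  obtain ⟨P, hP, hw⟩ := fv_bigAnd hw
  rw [← List.map_uncurry_zip_eq_zipWith] at hP
  obtain ⟨⟨a, b⟩, hq, rfl⟩ := List.mem_map.1 hP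
  have := List.of_mem_zip hq
  simp only [Function.uncurry, SAFormula.fv, Term.fv, Finset.mem_union,
    Finset.mem_singleton] at hw
  rcases hw with rfl | rfl
  exacts [⟨a, rfl, .inl this.1⟩, ⟨b, rfl, .inr this.2⟩]

theorem pairEq_diffFree {S : Signature} (as bs : List ℕ) :
    (pairEq as bs : SAFormula S).DiffFree := by
  refine SAFormula.DiffFree.bigAnd fun P hP => ?_
  rw [← List.map_uncurry_zip_eq_zipWith] at hP
  obtain ⟨⟨a, b⟩, hq, rfl⟩ := List.mem_map.1 hP
  exact ⟨rfl, rfl⟩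

theorem vecEq_eq (E : ODE L.toSignature) (ys) : vecEq E ys = pairEq E.names ys := rfl

theorem vecEq_diffFree (E : ODE L.toSignature) (ys) : (vecEq E ys).DiffFree := pairEq_diffFree _ _

theorem or_vecEq_diffFree {E : ODE L.toSignature} {ys} {P : SAFormula L.toSignature}
    (hP : P.DiffFree) : (SAFormula.or P (vecEq E ys)).DiffFree := ⟨hP, vecEq_diffFree E ys⟩

theorem exists_freshFor (E : ODE L.toSignature) (B : Finset Var) :
    ∃ ys, FreshFor E ys ∧ ∀ y ∈ ys, Var.base y ∉ B := by
  obtain ⟨n, hn⟩ := exists_name_lt (B ∪ E.rhsFv ∪ (E.names.map Var.base).toFinset)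
  have hn' : ∀ m, n ≤ m → Var.base m ∉ B ∧ Var.base m ∉ E.rhsFv ∧ m ∉ E.names := by
    intro m hm
    have := fun h => not_lt.2 hm (hn (.base m) h)
    simp only [Finset.mem_union, List.mem_toFinset, List.mem_map] at this
    exact ⟨fun h => this (by simp [h]), fun h => this (by simp [h]), fun h => this (.inr ⟨m, h, rfl⟩)⟩
  refine ⟨(List.range E.length).map (n + ·), ⟨by simp, ?_, ?_⟩, ?_⟩
  · exact List.nodup_range.map (add_right_injective n)
  · intro y hy
    obtain ⟨i, -, rfl⟩ := List.mem_map.1 hy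
    exact ⟨(hn' _ (Nat.le_add_right _ _)).2.2, (hn' _ (Nat.le_add_right _ _)).2.1⟩
  · intro y hy
    obtain ⟨i, -, rfl⟩ := List.mem_map.1 hy
    exact (hn' _ (Nat.le_add_right _ _)).1

/-- The initial values may be given fresh names. -/
theorem Derives.intro_vecEq {Γ φ} {E : ODE L.toSignature} {ys : List ℕ} (hys : FreshFor E ys)
    (hΓ : ∀ y ∈ ys, ∀ χ ∈ Γ, Var.base y ∉ χ.fv) (hφ : ∀ y ∈ ys, Var.base y ∉ φ.fv)
    (h : Derives T ((vecEq E ys).toFormula :: Γ) φ) : Derives T Γ φ := by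
  have hlen : ys.length = E.names.length := by rw [hys.1, ODE.names, List.length_map]
  let l : List (Var × Term L.toSignature) :=
    (ys.zip E.names).map fun q => (.base q.1, .var (.base q.2))
  have hl : ∀ p ∈ l, ∃ y ∈ ys, ∃ x ∈ E.names, p = (.base y, .var (.base x)) := by
    intro p hp
    obtain ⟨⟨y, x⟩, hq, rfl⟩ := List.mem_map.1 hp
    have := List.of_mem_zip hq
    exact ⟨y, this.1, x, this.2, rfl⟩
  refine .intro_eqs l ?_ ?_ ?_ ?_ ?_
  · have : l.map Prod.fst = ys.map Var.base := by
      rw [List.map_map]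
      conv_rhs => rw [← List.map_fst_zip hlen.le, List.map_map]
      rfl
    rw [this]
    exact hys.2.1.map Var.base_injective
  · intro p hp χ hχ
    obtain ⟨y, hy, x, hx, rfl⟩ := hl p hp
    exact hΓ y hy χ hχ
  · intro p hp
    obtain ⟨y, hy, x, hx, rfl⟩ := hl p hp
    exact hφ y hy
  · intro p hp q hq
    obtain ⟨y, hy, x, hx, rfl⟩ := hl p hp
    obtain ⟨y', hy', x', hx', rfl⟩ := hl q hq
    intro hw
    obtain rfl := Var.base_injective (Finset.mem_singleton.1 hw)
    exact (hys.2.2 _ hy).1 hx'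
  · refine .of_maxCon fun M hM hH => hM.closed (l := (vecEq E ys).toFormula :: Γ) ?_ h
    intro ψ hψ
    rcases List.mem_cons.1 hψ with rfl | hψ
    · refine hM.arith ((ys.zip E.names).map fun q =>
        .cmp .eq (.var (.base q.1)) (.var (.base q.2))) (fun v hv => ?_) fun Q hQ => ?_
      · rw [vecEq_eq, asat_pairEq]
        intro i h h'
        exact (hv _ (List.mem_map.2 ⟨(ys[i], E.names[i]),
          List.mem_iff_getElem.2 ⟨i, by simp [h, h'], by simp⟩, rfl⟩)).symm
      · obtain ⟨q, hq, rfl⟩ := List.mem_map.1 hQ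
        exact hH _ (List.mem_append_left _
          (List.mem_map.2 ⟨_, List.mem_map.2 ⟨q, hq, rfl⟩, rfl⟩))
    · exact hH ψ (List.mem_append_right _ hψ)

/-- `|x - y|²` -/
def sqDist {S : Signature} (as bs : List ℕ) : Term S :=
  .sum ((as.zip bs).map fun q => .mul (.sub (.var (.base q.1)) (.var (.base q.2)))
    (.sub (.var (.base q.1)) (.var (.base q.2))))

theorem sqDist_diffFree (as bs : List ℕ) :
    (sqDist as bs : Term L.toSignature).DiffFree := by
  refine Term.DiffFree.sum fun d hd => ?_
  obtain ⟨q, -, rfl⟩ := List.mem_map.1 hd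
  exact ⟨Term.DiffFree.sub rfl rfl, Term.DiffFree.sub rfl rfl⟩

theorem aeval_sqDist {S : Signature} (v : Term S → ℝ) (as bs : List ℕ) :
    (sqDist as bs).aeval v = ((as.zip bs).map fun q =>
      (v (.var (.base q.1)) - v (.var (.base q.2))) *
        (v (.var (.base q.1)) - v (.var (.base q.2)))).sum := by
  simp [sqDist, aeval_sum, Function.comp_def]

theorem aeval_sqDist_nonneg {S : Signature} (v : Term S → ℝ) (as bs : List ℕ) :
    0 ≤ (sqDist as bs).aeval v := by
  rw [aeval_sqDist]
  refine List.sum_nonneg fun x hx => ?_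
  obtain ⟨q, -, rfl⟩ := List.mem_map.1 hx
  exact mul_self_nonneg _

theorem aeval_sqDist_eq_zero {S : Signature} (v : Term S → ℝ) (as bs : List ℕ) :
    (sqDist as bs).aeval v = 0 ↔ (pairEq as bs).asat v := by
  rw [aeval_sqDist, asat_pairEq_zip]
  constructor
  · intro h q hq
    have := List.single_le_sum (l := (as.zip bs).map fun q =>
      (v (.var (.base q.1)) - v (.var (.base q.2))) *
        (v (.var (.base q.1)) - v (.var (.base q.2)))) (fun x hx => by
      obtain ⟨q, -, rfl⟩ := List.mem_map.1 hx
      exact mul_self_nonneg _) _ (List.mem_map.2 ⟨q, hq, rfl⟩)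
    rw [h] at this
    exact sub_eq_zero.1 (mul_self_eq_zero.1 (le_antisymm this (mul_self_nonneg _)))
  · intro h
    refine List.sum_eq_zero fun x hx => ?_
    obtain ⟨q, hq, rfl⟩ := List.mem_map.1 hx
    rw [h q hq]; ring

/-- Every summand is a square, so its derivative keeps a factor `a - b` that vanishes where the
vectors agree, whichever of the names evolve. -/
theorem aeval_lie_sqDist {E : ODE L.toSignature} {v as bs} (h : (pairEq as bs).asat v) :
    (lie L E (sqDist as bs)).aeval v = 0 := by
  rw [asat_pairEq_zip] at h
  rw [sqDist, aeval_lie_sum]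
  refine List.sum_eq_zero fun x hx => ?_
  obtain ⟨d, hd, rfl⟩ := List.mem_map.1 hx
  obtain ⟨q, hq, rfl⟩ := List.mem_map.1 hd
  simp [h q hq]

def Term.pow {S : Signature} (e : Term S) : ℕ → Term S
  | 0 => .const 1
  | n + 1 => .mul e (e.pow n)

@[simp] theorem aeval_pow {S : Signature} (v : Term S → ℝ) (e n) :
    (Term.pow e n).aeval v = e.aeval v ^ n := by
  induction n with
  | zero => simp [Term.pow]
  | succ n ih => rw [Term.pow, aeval_mul, ih, pow_succ']

theorem aeval_lie_pow (E : ODE L.toSignature) (v e) (n : ℕ) :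
    (lie L E (Term.pow e (n + 1))).aeval v =
      (n + 1) * e.aeval v ^ n * (lie L E e).aeval v := by
  induction n with
  | zero => simp [Term.pow]
  | succ n ih => rw [Term.pow, aeval_lie_mul, ih, aeval_pow]; push_cast; ring

theorem Term.DiffFree.pow {S : Signature} {e : Term S} (he : e.DiffFree) (n) :
    (e.pow n).DiffFree := by
  induction n with
  | zero => trivial
  | succ n ih => exact ⟨he, ih⟩

/-! ### Local progress -/

/-- Continuous existence, for `y` that may occur in `e`. -/
theorem Derives.cont {E : ODE L.toSignature} {ys : List ℕ} {e : Term L.toSignature}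
    (hCont : contAxioms L ⊆ T) (hE : E.WF) (hEv : E.LocallyEvolves) (hys : FreshFor E ys)
    (he : e.DiffFree) : Derives T [(vecEq E ys).toFormula, (gtZ e).toFormula]
      (.dia (.ode E (gtZ e)) (.not (vecEq E ys).toFormula)) := by
  -- Cont requires names not occurring in `e`, but it will be applied to terms containing `|x -
  -- y|²`. So the initial values get second names `z`; the equation `y = z` persists along the flow,
  -- and leaving `z` means leaving `y`.
  obtain ⟨zs, hzs, hz⟩ := exists_freshFor E (e.fv ∪ (ys.map Var.base).toFinset)
  have hz₁ : ∀ z ∈ zs, Var.base z ∉ e.fv := fun z h h' => hz z h (by simp [h'])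
  have hz₂ : ∀ z ∈ zs, z ∉ ys := fun z h h' =>
    hz z h (Finset.mem_union_right _ (List.mem_toFinset.2 (List.mem_map.2 ⟨z, h', rfl⟩)))
  have hlen : ys.length = E.names.length := by rw [hys.1, ODE.names, List.length_map]
  have hlen' : zs.length = E.names.length := by rw [hzs.1, ODE.names, List.length_map]
  have hz₃ : ∀ z ∈ zs, Var.base z ∉ (vecEq E ys).fv := by
    intro z h hw
    obtain ⟨n, h₁, h₂⟩ := fv_pairEq hw
    obtain rfl := Var.base_injective h₁
    exact h₂.elim (hzs.2.2 z h).1 (hz₂ z h)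
  have hgt : (gtZ e).fv = e.fv := by simp [gtZ, SAFormula.fv, Term.fv]
  refine .intro_vecEq hzs ?_ ?_ (.of_maxCon fun M hM hH => ?_)
  · intro z h χ hχ
    simp only [List.mem_cons, List.not_mem_nil, or_false] at hχ
    rcases hχ with rfl | rfl
    · rw [SAFormula.fv_toFormula]; exact hz₃ z h
    · rw [SAFormula.fv_toFormula, hgt]; exact hz₁ z h
  · intro z h hw
    rcases fv_box_ode (E := E) (Q := gtZ e) hw with ⟨n, hn, hw⟩ | hw | hw | hw
    · exact (hzs.2.2 z h).1 (Var.base_injective hw ▸ hn)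
    · exact (hzs.2.2 z h).2 hw
    · exact hz₁ z h (hgt ▸ hw)
    · exact hz₃ z h ((vecEq E ys).fv_toFormula ▸ hw)
  · simp only [List.mem_cons, List.not_mem_nil, or_false, forall_eq_or_imp, forall_eq] at hH
    obtain ⟨h₁, h₂, h₃⟩ := hH
    have hc := hM.of_derives (.ax (hCont ⟨E, e, zs, hE, hEv, he, hzs, hz₁, rfl⟩))
    refine hM.dia_mono ?_ ((hM.mem_iff.1 (hM.mem_imp.1 hc h₁)).2 h₃)
    have h₄ : (pairEq ys zs).toFormula ∈ M := by
      refine hM.arith2 (fun v h₁ h₂ => ?_) h₁ h₂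
      rw [vecEq_eq, asat_pairEq] at h₁ h₂
      rw [asat_pairEq]
      intro i h h'
      rw [← h₁ i (by omega) h', ← h₂ i (by omega) h]
    refine hM.box_mono (fun M' hM' h => ?_) (hM.vacuous (φ := (pairEq ys zs).toFormula) ?_ h₄)
    · rw [hM'.mem_imp, hM'.mem_not, hM'.mem_not]
      refine fun hn h' => hn (hM'.arith2 (fun v h₁ h₂ => ?_) h h')
      rw [vecEq_eq, asat_pairEq] at h₂ ⊢
      rw [asat_pairEq] at h₁
      intro i h h'
      rw [← h₁ i (by omega) h', ← h₂ i (by omega) (by omega)]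
    · rw [SAFormula.fv_toFormula, Finset.disjoint_left]
      intro w hw
      obtain ⟨n, rfl, h⟩ := fv_pairEq hw
      rw [Program.bv, ODE.base_mem_bv]
      exact h.elim (fun h => (hys.2.2 n h).1) (fun h => (hzs.2.2 n h).1)

-- Rules for the progress modality in an initial state

/-- `M` describes an initial state `x = y` of `x' = f(x)`. -/
structure Initial (T : Set (Formula L.toSignature)) (E : ODE L.toSignature) (ys : List ℕ)
    (M : Set (Formula L.toSignature)) : Prop where
  maxCon : MaxCon T M
  cont : contAxioms L ⊆ T
  uniq : uniqAxioms L ⊆ T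
  wf : E.WF
  evolves : E.LocallyEvolves
  fresh : FreshFor E ys
  zero : ZeroDiffs M
  eq : (vecEq E ys).toFormula ∈ M

namespace Initial

variable {E : ODE L.toSignature} {ys : List ℕ} {M : Set (Formula L.toSignature)}
  (hM : Initial T E ys M)
include hM

theorem dia_cont {e : Term L.toSignature} (he : e.DiffFree) (h : (gtZ e).toFormula ∈ M) :
    Formula.dia (.ode E (gtZ e)) (.not (vecEq E ys).toFormula) ∈ M :=
  hM.maxCon.closed (l := [(vecEq E ys).toFormula, (gtZ e).toFormula]) (by simp [hM.eq, h])
    (.cont hM.cont hM.wf hM.evolves hM.fresh he)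

theorem dia_uniq {Q R : SAFormula L.toSignature} {φ} (hQ : Q.DiffFree) (hR : R.DiffFree)
    (h₁ : Formula.dia (.ode E Q) φ ∈ M) (h₂ : Formula.dia (.ode E R) φ ∈ M) :
    Formula.dia (.ode E (.and Q R)) φ ∈ M :=
  (hM.maxCon.mem_iff.1 (hM.maxCon.of_derives
    (.ax (hM.uniq ⟨E, Q, R, φ, hM.wf, hQ, hR, rfl⟩)))).2 (hM.maxCon.mem_and.2 ⟨h₁, h₂⟩)

/-- Progress into `P`, from progress inside a domain constraint on which `P ∨ x = y` holds. -/
theorem progress_of_dia {P Q : SAFormula L.toSignature} (hP : P.DiffFree) (hQ : Q.DiffFree)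
    (h : Formula.box (.ode E Q) (SAFormula.or P (vecEq E ys)).toFormula ∈ M)
    (h' : Formula.dia (.ode E Q) (.not (vecEq E ys).toFormula) ∈ M) :
    progress E ys P ∈ M :=
  hM.maxCon.dia_domain hM.wf hQ (or_vecEq_diffFree hP) h h'

theorem progress_mono {P Q : SAFormula L.toSignature} (hP : P.DiffFree) (hQ : Q.DiffFree)
    (h : ∀ M', MaxCon T M' → P.toFormula ∈ M' → Q.toFormula ∈ M')
    (h' : progress E ys P ∈ M) : progress E ys Q ∈ M :=
  hM.progress_of_dia hQ (or_vecEq_diffFree hP)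
    (hM.maxCon.box_mono (fun M' hM' h₁ => hM'.mem_or.2 ((hM'.mem_or.1 h₁).imp_left (h M' hM')))
      (hM.maxCon.domain hM.wf (or_vecEq_diffFree hP))) h'

/-- Uniq merges the two domain constraints, and `(P ∨ x = y) ∧ (Q ∨ x = y)` implies `(P ∧ Q) ∨ x =
y`. -/
theorem progress_and {P Q : SAFormula L.toSignature} (hP : P.DiffFree) (hQ : Q.DiffFree)
    (h₁ : progress E ys P ∈ M) (h₂ : progress E ys Q ∈ M) : progress E ys (.and P Q) ∈ M := by
  have hP' := or_vecEq_diffFree (E := E) (ys := ys) hP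
  have hQ' := or_vecEq_diffFree (E := E) (ys := ys) hQ
  refine hM.progress_of_dia (Q := .and _ _) ⟨hP, hQ⟩ ⟨hP', hQ'⟩ ?_ (hM.dia_uniq hP' hQ' h₁ h₂)
  refine hM.maxCon.box_mono (fun M' hM' => hM'.arith1 fun v => ?_)
    (hM.maxCon.domain hM.wf (Q := .and _ _) ⟨hP', hQ'⟩)
  simp only [asat_and, asat_or]
  tauto

/-- By Uniq, progress into both would give a run inside `(P ∨ x = y) ∧ (¬P ∨ x = y)`, which forces
`x = y` and so never reaches `x ≠ y`. -/
theorem progress_not {P : SAFormula L.toSignature} (hP : P.DiffFree)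
    (h : progress E ys P ∈ M) : progress E ys (.not P) ∉ M := by
  intro h'
  have hP' := or_vecEq_diffFree (E := E) (ys := ys) hP
  have hQ' := or_vecEq_diffFree (E := E) (ys := ys) (P := .not P) hP
  have hd := hM.dia_uniq hP' hQ' h h'
  rw [hM.maxCon.mem_dia] at hd
  refine hd (hM.maxCon.box_mono (fun M' hM' h₁ => ?_)
    (hM.maxCon.domain hM.wf (Q := .and _ _) ⟨hP', hQ'⟩))
  rw [hM'.mem_not, hM'.mem_not, not_not]
  refine hM'.arith1 (fun v => ?_) h₁
  simp only [asat_and, asat_or, asat_not]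
  tauto

/-- Progress of `u₀ > 0` from the first nonzero value in the sequence of its Lie derivatives. -/
theorem progress_of_lie (u : ℕ → Term L.toSignature) (k : ℕ) (hu : ∀ j, (u j).DiffFree)
    (hlie : ∀ j v, (lie L E (u j)).aeval v = (u (j + 1)).aeval v)
    (h₀ : ∀ j < k, (eqZ (u j)).toFormula ∈ M) (hk : (gtZ (u k)).toFormula ∈ M) :
    progress E ys (gtZ (u 0)) ∈ M := by
  -- `r = |x - y|²` vanishes initially together with its derivative, so `a = u_k - r` and `b = 1 -
  -- (k + 1) r'` are positive at the start, and Cont applies to both.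
  let r : Term L.toSignature := sqDist E.names ys
  have hr : r.DiffFree := sqDist_diffFree _ _
  let a : Term L.toSignature := (u k).sub r
  let b : Term L.toSignature := .sub (.const 1) (.mul (.const (k + 1)) (lie L E r))
  have ha : a.DiffFree := (hu k).sub hr
  have hb : b.DiffFree := Term.DiffFree.sub trivial ⟨trivial, hr.lie hM.wf⟩
  have hQ : (SAFormula.and (gtZ a) (gtZ b)).DiffFree := ⟨⟨ha, trivial⟩, ⟨hb, trivial⟩⟩
  have hdom := hM.maxCon.domain hM.wf hQ
  have hdia : Formula.dia (.ode E (.and (gtZ a) (gtZ b))) (.not (vecEq E ys).toFormula) ∈ M := by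
    refine hM.dia_uniq ⟨ha, trivial⟩ ⟨hb, trivial⟩ (hM.dia_cont ha ?_) (hM.dia_cont hb ?_)
    · refine hM.maxCon.arith2 (fun v h₁ h₂ => ?_) hk hM.eq
      rw [vecEq_eq, ← aeval_sqDist_eq_zero] at h₂
      simpa [a, r, h₂] using h₁
    · refine hM.maxCon.arith1 (fun v h => ?_) hM.eq
      rw [vecEq_eq] at h
      simp [b, r, aeval_lie_sqDist h]
  -- Integrate downwards: if `u_{j+1} ≥ r^(i+1)`, then `u_j - r^(i+2)` has derivative at least
  -- `r^(i+1) (1 - (i + 2) r')`, which is nonnegative, and it starts at `0`.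
  have key : ∀ i ≤ k, Formula.box (.ode E (.and (gtZ a) (gtZ b)))
      (geZ ((u (k - i)).sub (r.pow (i + 1)))).toFormula ∈ M := by
    intro i
    induction i with
    | zero =>
      intro _
      refine hM.maxCon.box_mono (fun M' hM' => hM'.arith1 fun v h => ?_) hdom
      simp only [asat_and, asat_gtZ, a, aeval_sub] at h
      simp only [asat_geZ, aeval_sub, aeval_pow, zero_add, pow_one, Nat.sub_zero]
      exact h.1.le
    | succ i ih =>
      intro hi
      obtain ⟨j, rfl⟩ := Nat.exists_eq_add_of_le hi
      have e₁ : i + 1 + j - i = j + 1 := by omega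
      have e₂ : i + 1 + j - (i + 1) = j := by omega
      have ih := ih (by omega)
      rw [e₁] at ih
      rw [e₂]
      refine hM.maxCon.invariant_ge hM.wf hQ ((hu j).sub (hr.pow _)) hM.zero ?_ ?_
      · refine hM.maxCon.box_mono2 (fun M' hM' => hM'.arith2 fun v h₁ h₂ => ?_) hdom ih
        simp only [asat_and, asat_gtZ, asat_geZ, aeval_sub, aeval_pow, aeval_lie_sub,
          aeval_lie_pow, hlie, b, aeval_mul, aeval_const] at h₁ h₂ ⊢
        have hr₀ : 0 ≤ r.aeval v ^ (i + 1) := pow_nonneg (aeval_sqDist_nonneg _ _ _) _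
        have h₃ := h₁.2
        push_cast at h₃ ⊢
        generalize (lie L E r).aeval v = d at *
        -- The domain bounds `(k + 1) r'` by `1`, where `k + 1 = i + j + 2`. For `r' ≥ 0` this also
        -- bounds the smaller multiple; for `r' ≤ 0` there is nothing to bound.
        have h₄ : 0 ≤ 1 - ((i : ℝ) + 1 + 1) * d := by
          rcases le_total d 0 with hd | hd
          · nlinarith [(Nat.cast_nonneg i : (0 : ℝ) ≤ i)]
          · nlinarith [mul_nonneg (Nat.cast_nonneg j : (0 : ℝ) ≤ j) hd]
        nlinarith [mul_nonneg hr₀ h₄]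
      · refine hM.maxCon.arith2 (fun v h₁ h₂ => ?_) (h₀ j (by omega)) hM.eq
        rw [vecEq_eq, ← aeval_sqDist_eq_zero] at h₂
        simp only [asat_eqZ] at h₁
        simp [h₁, r, h₂]
  refine hM.progress_of_dia ⟨hu 0, trivial⟩ hQ ?_ hdia
  refine hM.maxCon.box_mono (fun M' hM' => hM'.arith1 fun v h => ?_) (key k le_rfl)
  simp only [Nat.sub_self, asat_geZ, aeval_sub, aeval_pow] at h
  rw [asat_or, asat_gtZ, vecEq_eq, ← aeval_sqDist_eq_zero]
  -- `u_0 ≥ r^(k+1)` is strictly positive except where `r = 0`, that is, where `x = y`.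
  rcases (aeval_sqDist_nonneg v E.names ys).eq_or_lt with h' | h'
  · exact .inr h'.symm
  · exact .inl (by linarith [pow_pos h' (k + 1)])

/-- Cont for the constant term `1` says that the flow leaves `y` at all. -/
theorem progress_valid {P : SAFormula L.toSignature} (hP : P.DiffFree)
    (h : ∀ M', MaxCon T M' → P.toFormula ∈ M') : progress E ys P ∈ M := by
  have h₁ : (Term.const 1 : Term L.toSignature).DiffFree := trivial
  refine hM.progress_of_dia (Q := gtZ (.const 1)) hP ⟨h₁, trivial⟩ ?_
    (hM.dia_cont h₁ (hM.maxCon.arith0 fun v => by simp))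
  exact hM.maxCon.box_of fun M' hM' => hM'.mem_or.2 (.inl (h M' hM'))

theorem progress_bigAnd {l : List (SAFormula L.toSignature)} (hl : ∀ P ∈ l, P.DiffFree)
    (h : ∀ P ∈ l, progress E ys P ∈ M) : progress E ys (.bigAnd l) ∈ M := by
  induction l with
  | nil => exact hM.progress_valid ⟨trivial, trivial⟩ fun M' hM' => hM'.arith0 fun v => rfl
  | cons P l ih =>
    cases l with
    | nil => exact h P (by simp)
    | cons Q l =>
      exact hM.progress_and (hl P (by simp)) (.bigAnd fun R hR => hl R (by simp [hR]))
        (h P (by simp)) (ih (fun R hR => hl R (by simp [hR])) fun R hR => h R (by simp [hR]))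

theorem progress_bigOr {l : List (SAFormula L.toSignature)} (hl : ∀ P ∈ l, P.DiffFree)
    {P} (hP : P ∈ l) (h : progress E ys P ∈ M) : progress E ys (.bigOr l) ∈ M :=
  hM.progress_mono (hl P hP) (.bigOr hl) (fun _ hM' => hM'.arith1 fun v h =>
    (asat_bigOr v l).2 ⟨P, hP, h⟩) h

theorem progress_not_bigAnd {l : List (SAFormula L.toSignature)} (hl : ∀ P ∈ l, P.DiffFree)
    {P} (hP : P ∈ l) (h : progress E ys (.not P) ∈ M) : progress E ys (.not (.bigAnd l)) ∈ M :=
  hM.progress_mono (P := .not P) (Q := .not (.bigAnd l)) (hl P hP) (SAFormula.DiffFree.bigAnd hl)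
    (fun M' hM' => hM'.arith1 fun v h => by
      rw [asat_not] at *; exact fun h' => h ((asat_bigAnd v l).1 h' P hP)) h

theorem progress_not_bigOr {l : List (SAFormula L.toSignature)} (hl : ∀ P ∈ l, P.DiffFree)
    (h : ∀ P ∈ l, progress E ys (.not P) ∈ M) : progress E ys (.not (.bigOr l)) ∈ M := by
  have hl' : ∀ P ∈ l.map SAFormula.not, P.DiffFree := by
    intro P hP
    obtain ⟨Q, hQ, rfl⟩ := List.mem_map.1 hP
    exact hl Q hQ
  refine hM.progress_mono (Q := .not (.bigOr l)) (.bigAnd hl') (SAFormula.DiffFree.bigOr hl)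
    (fun M' hM' => hM'.arith1 fun v h => ?_) (hM.progress_bigAnd hl' (by simpa using h))
  simpa using h

end Initial

/-! ### Progress formulas -/

theorem asat_guarded (E : ODE L.toSignature) (v e k P) :
    (guarded E e k P).asat v ↔ ((∀ i < k, (lieN L E i e).aeval v = 0) → P.asat v) := by
  cases k with
  | zero => simp [guarded]
  | succ k => rw [guarded, asat_imp, asat_progEq]

theorem asat_progGt (E : ODE L.toSignature) (v e N) : (progGt E e N).asat v ↔
    (∀ k < N - 1, (∀ i < k, (lieN L E i e).aeval v = 0) → 0 ≤ (lieN L E k e).aeval v) ∧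
      ((∀ i < N - 1, (lieN L E i e).aeval v = 0) → 0 < (lieN L E (N - 1) e).aeval v) := by
  simp only [progGt, asat_bigAnd, List.forall_mem_append, List.forall_mem_map, List.mem_range,
    asat_guarded, asat_geZ, List.mem_singleton, forall_eq, asat_gtZ]

theorem progEq_diffFree {E : ODE L.toSignature} (hE : E.WF) {e : Term L.toSignature}
    (he : e.DiffFree) (N) : (progEq E e N).DiffFree := by
  refine .bigAnd fun P hP => ?_
  obtain ⟨i, -, rfl⟩ := List.mem_map.1 hP
  exact ⟨he.lieN hE i, trivial⟩

theorem guarded_diffFree {E : ODE L.toSignature} (hE : E.WF) {e : Term L.toSignature}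
    (he : e.DiffFree) (k) {P : SAFormula L.toSignature} (hP : P.DiffFree) :
    (guarded E e k P).DiffFree := by
  cases k with
  | zero => exact hP
  | succ k => exact ⟨progEq_diffFree hE he _, hP⟩

theorem progGt_diffFree {E : ODE L.toSignature} (hE : E.WF) {e : Term L.toSignature}
    (he : e.DiffFree) (N) : (progGt E e N).DiffFree := by
  refine .bigAnd fun P hP => ?_
  rcases List.mem_append.1 hP with hP | hP
  · obtain ⟨k, -, rfl⟩ := List.mem_map.1 hP
    exact guarded_diffFree hE he _ ⟨he.lieN hE k, trivial⟩
  · obtain rfl := List.mem_singleton.1 hP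
    exact guarded_diffFree hE he _ ⟨he.lieN hE _, trivial⟩

theorem NormalForm.prog_diffFree {E : ODE L.toSignature} (hE : E.WF) {ρ} {D : NormalForm L}
    (hD : ∀ p ∈ D, ∀ e ∈ p.1 ++ p.2, e.DiffFree) : (D.prog E ρ).DiffFree := by
  refine .bigOr fun P hP => ?_
  obtain ⟨p, hp, rfl⟩ := List.mem_map.1 hP
  refine ⟨.bigAnd fun P hP => ?_, .bigAnd fun P hP => ?_⟩ <;>
  · obtain ⟨e, he, rfl⟩ := List.mem_map.1 hP
    have he := hD p hp e (by simp [he])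
    first
    | exact ⟨progGt_diffFree hE he _, progEq_diffFree hE he _⟩
    | exact progGt_diffFree hE he _

theorem MaxCon.mem_bigAnd {M : Set (Formula L.toSignature)} (hM : MaxCon T M)
    {l : List (SAFormula L.toSignature)} :
    (SAFormula.bigAnd l).toFormula ∈ M ↔ ∀ P ∈ l, P.toFormula ∈ M := by
  refine ⟨fun h P hP => hM.arith1 (fun v h => (asat_bigAnd v l).1 h P hP) h, fun h => ?_⟩
  exact hM.arith l (fun v => (asat_bigAnd v l).2) h

theorem MaxCon.mem_bigOr {M : Set (Formula L.toSignature)} (hM : MaxCon T M)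
    {l : List (SAFormula L.toSignature)} :
    (SAFormula.bigOr l).toFormula ∈ M ↔ ∃ P ∈ l, P.toFormula ∈ M := by
  refine ⟨fun h => ?_, fun ⟨P, hP, h⟩ => hM.arith1 (fun v h => (asat_bigOr v l).2 ⟨P, hP, h⟩) h⟩
  by_contra! hn
  have h₁ := hM.mem_bigAnd (l := l.map .not)
  have h₂ : (SAFormula.not (.bigOr l)).toFormula ∈ M := by
    refine hM.arith1 (fun v h => ?_) (h₁.2 fun P hP => ?_)
    · simpa using h
    · obtain ⟨Q, hQ, rfl⟩ := List.mem_map.1 hP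
      exact hM.mem_not.2 (hn Q hQ)
  exact hM.mem_not.1 h₂ h

-- Deciding local progress by progress formulas

namespace Initial

variable {E : ODE L.toSignature} {ys : List ℕ} {M : Set (Formula L.toSignature)}
  (hM : Initial T E ys M)
include hM

/-- The sign of the first nonzero Lie derivative decides local progress. -/
theorem trichotomy {e : Term L.toSignature} {N : ℕ} (he : e.DiffFree) (hN : IsRank T E e N) :
    ((progEq E e N).toFormula ∈ M ∧ (progGt E e N).toFormula ∉ M ∧ progress E ys (eqZ e) ∈ M) ∨
    ((progGt E e N).toFormula ∈ M ∧ progress E ys (gtZ e) ∈ M) ∨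
    ((progGt E e N).toFormula ∉ M ∧ (progEq E e N).toFormula ∉ M ∧
      progress E ys (gtZ e.neg) ∈ M) := by
  classical
  have hmc := hM.maxCon
  have hN₁ := hN.1
  by_cases hall : ∀ i < N, (eqZ (lieN L E i e)).toFormula ∈ M
  · have h₀ : (progEq E e N).toFormula ∈ M := hmc.mem_bigAnd.2 fun P hP => by
      obtain ⟨i, hi, rfl⟩ := List.mem_map.1 hP
      exact hall i (List.mem_range.1 hi)
    refine .inl ⟨h₀, hmc.mem_not.1 (hmc.arith1 (P := .not _) (fun v h => ?_) h₀), ?_⟩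
    · rw [asat_progEq] at h
      rw [asat_not, asat_progGt]
      rintro ⟨-, h'⟩
      exact (h' fun i hi => h i (by omega)).ne' (h _ (by omega))
    · have h₁ : (Term.const 1 : Term L.toSignature).DiffFree := trivial
      -- Under the trivial domain `1 > 0` the flow moves by Cont, and invariance of the radical
      -- keeps `e = 0` along it.
      refine hM.progress_of_dia (Q := gtZ (.const 1)) ⟨he, trivial⟩ ⟨h₁, trivial⟩ ?_
        (hM.dia_cont h₁ (hmc.arith0 fun v => by simp))
      refine hmc.box_mono (fun M' hM' => hM'.arith1 fun v h => ?_)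
        (hmc.radical_invariant hM.wf ⟨h₁, trivial⟩ he hN h₀)
      rw [asat_progEq] at h
      exact .inl ((asat_eqZ v e).2 (h 0 hN₁))
  · push Not at hall
    -- The least index whose Lie derivative is not declared zero by `M`; as `M` decides
    -- disjunctions, it declares a strict sign there.
    obtain ⟨hk, hk'⟩ := Nat.find_spec hall
    have hlt : ∀ j < Nat.find hall, (eqZ (lieN L E j e)).toFormula ∈ M := fun j hj => by
      have := Nat.find_min hall hj
      push Not at this
      exact this (by omega)
    generalize Nat.find hall = k at *
    have h₀ : (progEq E e k).toFormula ∈ M := hmc.mem_bigAnd.2 fun P hP => by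
      obtain ⟨i, hi, rfl⟩ := List.mem_map.1 hP
      exact hlt i (List.mem_range.1 hi)
    have hsign : (SAFormula.or (eqZ (lieN L E k e)) (.or (gtZ (lieN L E k e))
        (gtZ (lieN L E k e).neg))).toFormula ∈ M := hmc.arith0 fun v => by
      rcases lt_trichotomy ((lieN L E k e).aeval v) 0 with h | h | h <;> simp [h]
    rcases (hmc.mem_or.1 hsign).resolve_left hk' |> hmc.mem_or.1 with h | h
    · refine .inr (.inl ⟨hmc.arith2 (fun v h₁ h₂ => ?_) h₀ h,
        hM.progress_of_lie (fun j => lieN L E j e) k (he.lieN hM.wf)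
          (fun j v => by rw [lieN_succ]) hlt h⟩)
      rw [asat_progEq] at h₁
      rw [asat_gtZ] at h₂
      rw [asat_progGt]
      -- No satisfied guard reaches past `k`, so all conjuncts beyond index `k` hold vacuously.
      have key : ∀ j, (∀ i < j, (lieN L E i e).aeval v = 0) → j ≤ k := fun j hj => by
        by_contra! hn
        exact h₂.ne' (hj k hn)
      refine ⟨fun j hj hj' => ?_, fun hj' => ?_⟩
      · rcases (key j hj').eq_or_lt with rfl | h
        exacts [h₂.le, (h₁ j h).ge]
      · obtain rfl : k = N - 1 := le_antisymm (by omega) (key _ hj')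
        exact h₂
    · refine .inr (.inr ⟨hmc.mem_not.1 (hmc.arith2 (P := .not _) (fun v h₁ h₂ => ?_) h₀ h),
        hmc.mem_not.1 (hmc.arith1 (P := .not _) (fun v h₂ => ?_) h), ?_⟩)
      · rw [asat_progEq] at h₁
        rw [asat_gtZ, aeval_neg] at h₂
        rw [asat_not, asat_progGt]
        rintro ⟨h₃, h₄⟩
        -- The guard of conjunct `k` is satisfied, and that conjunct (strict exactly when `k = N -
        -- 1`) contradicts `e^(k) < 0`.
        rcases (show k ≤ N - 1 by omega).eq_or_lt with rfl | hk
        · linarith [h₄ h₁]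
        · linarith [h₃ k hk h₁]
      · rw [asat_gtZ, aeval_neg] at h₂
        rw [asat_not, asat_progEq]
        intro h
        linarith [h k hk]
      · refine hM.progress_of_lie (fun j => (lieN L E j e).neg) k (fun j => (he.lieN hM.wf j).neg)
          (fun j v => by simp only [lieN_succ, aeval_lie_neg, aeval_neg]) (fun j hj => ?_) h
        exact hmc.arith1 (fun v h => by simpa using h) (hlt j hj)

/-- The form with two implications, one for the progress formula and one for its failure, is what
propagates through conjunctions and disjunctions. The converses come only at the end, from
`progress_not`. -/
theorem progress_gtZ {e : Term L.toSignature} {N : ℕ} (he : e.DiffFree) (hN : IsRank T E e N) :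
    ((progGt E e N).toFormula ∈ M → progress E ys (gtZ e) ∈ M) ∧
    ((progGt E e N).toFormula ∉ M → progress E ys (.not (gtZ e)) ∈ M) := by
  have mono : ∀ P : SAFormula L.toSignature, P.DiffFree → (∀ v, P.asat v → e.aeval v ≤ 0) →
      progress E ys P ∈ M → progress E ys (.not (gtZ e)) ∈ M := fun P hP h =>
    hM.progress_mono (Q := .not (gtZ e)) hP ⟨he, trivial⟩ fun M' hM' => hM'.arith1 fun v hv => by
      rw [asat_not, asat_gtZ, not_lt]; exact h v hv
  rcases hM.trichotomy he hN with h | h | h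
  · exact ⟨fun h' => (h.2.1 h').elim,
      fun _ => mono (eqZ e) ⟨he, trivial⟩ (fun v h => ((asat_eqZ v e).1 h).le) h.2.2⟩
  · exact ⟨fun _ => h.2, fun h' => (h' h.1).elim⟩
  · exact ⟨fun h' => (h.1 h').elim, fun _ => mono (gtZ e.neg) ⟨he.neg, trivial⟩
      (fun v h => by rw [asat_gtZ, aeval_neg] at h; linarith) h.2.2⟩

theorem progress_geZ {e : Term L.toSignature} {N : ℕ} (he : e.DiffFree) (hN : IsRank T E e N) :
    ((progGe E e N).toFormula ∈ M → progress E ys (geZ e) ∈ M) ∧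
    ((progGe E e N).toFormula ∉ M → progress E ys (.not (geZ e)) ∈ M) := by
  have mono : ∀ P : SAFormula L.toSignature, P.DiffFree → (∀ v, P.asat v → 0 ≤ e.aeval v) →
      progress E ys P ∈ M → progress E ys (geZ e) ∈ M := fun P hP h =>
    hM.progress_mono hP ⟨he, trivial⟩ fun M' hM' => hM'.arith1 fun v hv => by
      rw [asat_geZ]; exact h v hv
  have hor : (progGe E e N).toFormula ∈ M ↔
      (progGt E e N).toFormula ∈ M ∨ (progEq E e N).toFormula ∈ M := hM.maxCon.mem_or
  rw [hor]
  rcases hM.trichotomy he hN with h | h | h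
  · exact ⟨fun _ => mono (eqZ e) ⟨he, trivial⟩ (fun v h => ((asat_eqZ v e).1 h).ge) h.2.2,
      fun h' => (h' (.inr h.1)).elim⟩
  · exact ⟨fun _ => mono (gtZ e) ⟨he, trivial⟩ (fun v h => ((asat_gtZ v e).1 h).le) h.2,
      fun h' => (h' (.inl h.1)).elim⟩
  · refine ⟨fun h' => (h'.elim h.1 h.2.1).elim, fun _ => ?_⟩
    refine hM.progress_mono (P := gtZ e.neg) (Q := .not (geZ e)) ⟨he.neg, trivial⟩ ⟨he, trivial⟩
      (fun M' hM' => hM'.arith1 fun v h => ?_) h.2.2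
    rw [asat_gtZ, aeval_neg] at h
    rw [asat_not, asat_geZ]
    linarith

/-- If progress into each of the formulas `F e` is decided by `G e`, then so it is for their
conjunction. -/
theorem progress_bigAnd_map {F G : Term L.toSignature → SAFormula L.toSignature}
    {l : List (Term L.toSignature)} (hF : ∀ e ∈ l, (F e).DiffFree)
    (h : ∀ e ∈ l, ((G e).toFormula ∈ M → progress E ys (F e) ∈ M) ∧
      ((G e).toFormula ∉ M → progress E ys (.not (F e)) ∈ M)) :
    ((SAFormula.bigAnd (l.map G)).toFormula ∈ M → progress E ys (.bigAnd (l.map F)) ∈ M) ∧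
    ((SAFormula.bigAnd (l.map G)).toFormula ∉ M →
      progress E ys (.not (.bigAnd (l.map F))) ∈ M) := by
  have hF' : ∀ P ∈ l.map F, P.DiffFree := by simpa using hF
  rw [hM.maxCon.mem_bigAnd, List.forall_mem_map]
  refine ⟨fun h' => hM.progress_bigAnd hF' fun P hP => ?_, fun h' => ?_⟩
  · obtain ⟨e, he, rfl⟩ := List.mem_map.1 hP
    exact (h e he).1 (h' e he)
  · push Not at h'
    obtain ⟨e, he, hn⟩ := h'
    exact hM.progress_not_bigAnd hF' (List.mem_map.2 ⟨e, he, rfl⟩) ((h e he).2 hn)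

/-- A failing progress formula fails in some conjunct of every disjunct. Progress into the negation
of that conjunct gives progress into the negated disjunct, and finitely many of these are conjoined.
-/
theorem progress_normalForm {D : NormalForm L} {ρ : Term L.toSignature → ℕ}
    (hD : ∀ p ∈ D, ∀ e ∈ p.1 ++ p.2, e.DiffFree ∧ IsRank T E e (ρ e)) :
    ((D.prog E ρ).toFormula ∈ M → progress E ys D.toSA ∈ M) ∧
    ((D.prog E ρ).toFormula ∉ M → progress E ys (.not D.toSA) ∈ M) := by
  have h₁ : ∀ p ∈ D, ∀ P ∈ p.1.map geZ, P.DiffFree := by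
    intro p hp P hP
    obtain ⟨e, he, rfl⟩ := List.mem_map.1 hP
    exact ⟨(hD p hp e (by simp [he])).1, trivial⟩
  have h₂ : ∀ p ∈ D, ∀ P ∈ p.2.map gtZ, P.DiffFree := by
    intro p hp P hP
    obtain ⟨e, he, rfl⟩ := List.mem_map.1 hP
    exact ⟨(hD p hp e (by simp [he])).1, trivial⟩
  have hge := fun p hp => hM.progress_bigAnd_map (F := geZ) (G := fun e => progGe E e (ρ e))
    (l := p.1) (fun e he => h₁ p hp _ (List.mem_map.2 ⟨e, he, rfl⟩))
    fun e he => hM.progress_geZ (hD p hp e (by simp [he])).1 (hD p hp e (by simp [he])).2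
  have hgt := fun p hp => hM.progress_bigAnd_map (F := gtZ) (G := fun e => progGt E e (ρ e))
    (l := p.2) (fun e he => h₂ p hp _ (List.mem_map.2 ⟨e, he, rfl⟩))
    fun e he => hM.progress_gtZ (hD p hp e (by simp [he])).1 (hD p hp e (by simp [he])).2
  have hDF : ∀ P ∈ D.map fun p => SAFormula.and (.bigAnd (p.1.map geZ)) (.bigAnd (p.2.map gtZ)),
      P.DiffFree := by
    intro P hP
    obtain ⟨p, hp, rfl⟩ := List.mem_map.1 hP
    exact ⟨.bigAnd (h₁ p hp), .bigAnd (h₂ p hp)⟩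
  rw [NormalForm.prog, hM.maxCon.mem_bigOr, NormalForm.toSA]
  constructor
  · rintro ⟨P, hP, h⟩
    obtain ⟨p, hp, rfl⟩ := List.mem_map.1 hP
    obtain ⟨ha, hb⟩ := hM.maxCon.mem_and.1 h
    exact hM.progress_bigOr hDF (List.mem_map.2 ⟨p, hp, rfl⟩)
      (hM.progress_and (.bigAnd (h₁ p hp)) (.bigAnd (h₂ p hp)) ((hge p hp).1 ha) ((hgt p hp).1 hb))
  · intro h
    refine hM.progress_not_bigOr hDF fun P hP => ?_
    obtain ⟨p, hp, rfl⟩ := List.mem_map.1 hP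
    have hn : (SAFormula.and (.bigAnd (p.1.map fun e => progGe E e (ρ e)))
        (.bigAnd (p.2.map fun e => progGt E e (ρ e)))).toFormula ∉ M :=
      fun h' => h ⟨_, List.mem_map.2 ⟨p, hp, rfl⟩, h'⟩
    have hand : (SAFormula.and (.bigAnd (p.1.map geZ)) (.bigAnd (p.2.map gtZ))).DiffFree :=
      hDF _ hP
    have hn := mt hM.maxCon.mem_and.2 hn
    rw [not_and_or] at hn
    rcases hn with hn | hn
    · refine hM.progress_mono (P := .not _) (Q := .not _) hand.1 hand (fun M' hM' =>
        hM'.arith1 fun v => ?_) ((hge p hp).2 hn)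
      rw [asat_not, asat_not, asat_and]; tauto
    · refine hM.progress_mono (P := .not _) (Q := .not _) hand.2 hand (fun M' hM' =>
        hM'.arith1 fun v => ?_) ((hgt p hp).2 hn)
      rw [asat_not, asat_not, asat_and]; tauto

/-- The two implications for the normal form have complementary premises and, by `progress_not`,
incompatible conclusions, so both can be reversed. Treating `¬P` along with `P` makes duality
immediate. -/
theorem progress_iff {P F : SAFormula L.toSignature} (hP : P.DiffFree)
    (hF : IsProgressFormula T E P F) :
    (progress E ys P ∈ M ↔ F.toFormula ∈ M) ∧ (progress E ys (.not P) ∈ M ↔ F.toFormula ∉ M) := by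
  obtain ⟨D, ρ, hD, hPD, rfl⟩ := hF
  have hDF : D.toSA.DiffFree := .bigOr fun P hP => by
    obtain ⟨p, hp, rfl⟩ := List.mem_map.1 hP
    refine ⟨.bigAnd fun P hP => ?_, .bigAnd fun P hP => ?_⟩ <;>
    · obtain ⟨e, he, rfl⟩ := List.mem_map.1 hP
      exact ⟨(hD p hp e (by simp [he])).1, trivial⟩
  have hiff : ∀ M', MaxCon T M' → (P.toFormula ∈ M' ↔ D.toSA.toFormula ∈ M') :=
    fun M' hM' => hM'.mem_iff.1 (hM'.of_derives hPD)
  have h₁ : (D.prog E ρ).toFormula ∈ M → progress E ys P ∈ M := fun h =>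
    hM.progress_mono hDF hP (fun M' hM' => (hiff M' hM').2) ((hM.progress_normalForm hD).1 h)
  have h₂ : (D.prog E ρ).toFormula ∉ M → progress E ys (.not P) ∈ M := fun h =>
    hM.progress_mono (P := .not _) (Q := .not P) hDF hP (fun M' hM' h' =>
      hM'.mem_not.2 fun hP => hM'.mem_not.1 h' ((hiff M' hM').1 hP))
      ((hM.progress_normalForm hD).2 h)
  have h₃ := fun h => hM.progress_not hP h
  tauto

end Initial

/-! ### Normal forms -/

/-- Conjunction of normal forms. -/
def NormalForm.conj (C D : NormalForm L) : NormalForm L :=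
  C.flatMap fun p => D.map fun q => (p.1 ++ q.1, p.2 ++ q.2)

mutual
/-- A normal form of `P`. -/
def SAFormula.nf : SAFormula L.toSignature → NormalForm L
  | .cmp .eq e d => [([e.sub d, d.sub e], [])]
  | .cmp .ge e d => [([e.sub d], [])]
  | .cmp .gt e d => [([], [e.sub d])]
  | .and P Q => P.nf.conj Q.nf
  | .or P Q => P.nf ++ Q.nf
  | .not P => P.nfNot
/-- A normal form of `¬P`. -/
def SAFormula.nfNot : SAFormula L.toSignature → NormalForm L
  | .cmp .eq e d => [([], [e.sub d]), ([], [d.sub e])]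
  | .cmp .ge e d => [([], [d.sub e])]
  | .cmp .gt e d => [([d.sub e], [])]
  | .and P Q => P.nfNot ++ Q.nfNot
  | .or P Q => P.nfNot.conj Q.nfNot
  | .not P => P.nf
end

theorem NormalForm.asat_toSA (v) (D : NormalForm L) : D.toSA.asat v ↔
    ∃ p ∈ D, (∀ e ∈ p.1, 0 ≤ e.aeval v) ∧ ∀ e ∈ p.2, 0 < e.aeval v := by
  simp [NormalForm.toSA]

theorem NormalForm.asat_conj (v) (C D : NormalForm L) :
    (C.conj D).toSA.asat v ↔ C.toSA.asat v ∧ D.toSA.asat v := by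
  simp only [NormalForm.asat_toSA, NormalForm.conj, List.mem_flatMap, List.mem_map]
  constructor
  · rintro ⟨_, ⟨p, hp, q, hq, rfl⟩, h₁, h₂⟩
    simp only [List.forall_mem_append] at h₁ h₂
    exact ⟨⟨p, hp, h₁.1, h₂.1⟩, q, hq, h₁.2, h₂.2⟩
  · rintro ⟨⟨p, hp, h₁⟩, q, hq, h₂⟩
    refine ⟨_, ⟨p, hp, q, hq, rfl⟩, ?_⟩
    simp only [List.forall_mem_append]
    exact ⟨⟨h₁.1, h₂.1⟩, h₁.2, h₂.2⟩

theorem NormalForm.asat_append (v) (C D : NormalForm L) :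
    (NormalForm.toSA (C ++ D : NormalForm L)).asat v ↔ C.toSA.asat v ∨ D.toSA.asat v := by
  simp only [NormalForm.asat_toSA, List.mem_append, or_and_right, exists_or]

/-- Both claims are proved together because negation exchanges `nf` and `nfNot`. -/
theorem SAFormula.asat_nf (v) (P : SAFormula L.toSignature) :
    (P.nf.toSA.asat v ↔ P.asat v) ∧ (P.nfNot.toSA.asat v ↔ ¬ P.asat v) := by
  induction P with
  | cmp c e d =>
    cases c <;> simp only [SAFormula.nf, SAFormula.nfNot, NormalForm.asat_toSA] <;> simp
    exact ⟨⟨fun h => le_antisymm h.2 h.1, fun h => ⟨h.ge, h.le⟩⟩, ne_comm⟩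
  | and P Q ih₁ ih₂ =>
    rw [SAFormula.nf, SAFormula.nfNot, NormalForm.asat_conj, NormalForm.asat_append, asat_and]
    tauto
  | or P Q ih₁ ih₂ =>
    rw [SAFormula.nf, SAFormula.nfNot, NormalForm.asat_conj, NormalForm.asat_append, asat_or]
    tauto
  | not P ih =>
    rw [SAFormula.nf, SAFormula.nfNot, asat_not]
    tauto

/-- The terms of the normal form are differential-free. -/
def NormalForm.DiffFree (D : NormalForm L) : Prop :=
  ∀ p ∈ D, ∀ e ∈ p.1 ++ p.2, Term.DiffFree e

theorem NormalForm.DiffFree.conj {C D : NormalForm L} (hC : C.DiffFree) (hD : D.DiffFree) :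
    (C.conj D).DiffFree := by
  intro p hp e he
  obtain ⟨q, hq, hp⟩ := List.mem_flatMap.1 hp
  obtain ⟨r, hr, rfl⟩ := List.mem_map.1 hp
  have h₁ := hC q hq e
  have h₂ := hD r hr e
  simp only [List.mem_append] at *
  tauto

theorem NormalForm.DiffFree.append {C D : NormalForm L} (hC : C.DiffFree) (hD : D.DiffFree) :
    NormalForm.DiffFree (C ++ D : NormalForm L) := fun p hp =>
  (List.mem_append.1 hp).elim (hC p) (hD p)

theorem SAFormula.DiffFree.nf {P : SAFormula L.toSignature} (hP : P.DiffFree) :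
    P.nf.DiffFree ∧ P.nfNot.DiffFree := by
  induction P with
  | cmp c e d =>
    have h₁ := hP.1.sub hP.2
    have h₂ := hP.2.sub hP.1
    cases c <;> simp [SAFormula.nf, SAFormula.nfNot, NormalForm.DiffFree, h₁, h₂]
  | and P Q ih₁ ih₂ =>
    rw [SAFormula.nf, SAFormula.nfNot]
    exact ⟨(ih₁ hP.1).1.conj (ih₂ hP.2).1, (ih₁ hP.1).2.append (ih₂ hP.2).2⟩
  | or P Q ih₁ ih₂ =>
    rw [SAFormula.nf, SAFormula.nfNot]
    exact ⟨(ih₁ hP.1).1.append (ih₂ hP.2).1, (ih₁ hP.1).2.conj (ih₂ hP.2).2⟩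
  | not P ih =>
    rw [SAFormula.nf, SAFormula.nfNot]
    exact (ih hP).symm

theorem exists_isProgressFormula (hRad : HasDiffRadicals L T) {E : ODE L.toSignature} (hE : E.WF)
    {P : SAFormula L.toSignature} (hP : P.DiffFree) : ∃ F, IsProgressFormula T E P F := by
  classical
  refine ⟨_, P.nf, fun e => if h : ∃ N, IsRank T E e N then h.choose else 0, ?_,
    .of_maxCon_nil fun M hM => ?_, rfl⟩
  · intro p hp e he
    have he' := hP.nf.1 p hp e he
    have h := hRad E e hE he'
    refine ⟨he', ?_⟩
    simpa only [dif_pos h] using h.choose_spec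
  · exact hM.mem_iff.2 ⟨hM.arith1 fun v => (P.asat_nf v).1.2, hM.arith1 fun v => (P.asat_nf v).1.1⟩

theorem SAFormula.DiffFree.order_toFormula {S : Signature} {P : SAFormula S} (hP : P.DiffFree)
    {w} (hw : w ∈ P.toFormula.fv) : w.order = 0 :=
  hP.order_eq_zero (P.fv_toFormula ▸ hw)

theorem order_progress {E : ODE L.toSignature} (hE : E.WF) {ys : List ℕ}
    {P : SAFormula L.toSignature} (hP : P.DiffFree) {w} (hw : w ∈ (progress E ys P).fv) :
    w.order = 0 := by
  -- Boxes and diamonds over the same program, like a formula and its negation, have the same free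
  -- variables by definition.
  rcases fv_box_ode (E := E) (Q := .or P (vecEq E ys)) hw with ⟨n, hn, rfl⟩ | hw | hw | hw
  · rfl
  · exact hE.order_eq_zero hw
  · exact (or_vecEq_diffFree hP).order_eq_zero hw
  · exact (vecEq_diffFree E ys).order_toFormula hw

theorem fv_iff (φ ψ : Formula L.toSignature) : (φ.iff ψ).fv = φ.fv ∪ ψ.fv := by
  ext; simp [Formula.iff, Formula.imp, Formula.fv]; tauto

theorem fv_imp (φ ψ : Formula L.toSignature) : (φ.imp ψ).fv = φ.fv ∪ ψ.fv := rfl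

end DL

-- The main theorem

theorem mainTheorem3 (L : DL.TermLanguage) (T : Set (DL.Formula L.toSignature))
    (hCont : DL.contAxioms L ⊆ T) (hUniq : DL.uniqAxioms L ⊆ T)
    (hRad : DL.HasDiffRadicals L T)
    (E : DL.ODE L.toSignature) (hE : E.WF) (hEv : E.LocallyEvolves) :
    (∀ P : DL.SAFormula L.toSignature, P.DiffFree → ∃ F, DL.IsProgressFormula T E P F) ∧
    (∀ (P F : DL.SAFormula L.toSignature) (ys : List ℕ), P.DiffFree →
      DL.IsProgressFormula T E P F → DL.FreshFor E ys → (∀ y ∈ ys, DL.Var.base y ∉ P.fv) →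
      F.DiffFree ∧
      DL.Derives T [] ((DL.vecEq E ys).toFormula.imp ((DL.progress E ys P).iff F.toFormula))) ∧
    (∀ (P : DL.SAFormula L.toSignature) (ys : List ℕ), P.DiffFree →
      DL.FreshFor E ys → (∀ y ∈ ys, DL.Var.base y ∉ P.fv) →
      DL.Derives T [] ((DL.vecEq E ys).toFormula.imp
        ((DL.progress E ys P).iff (.not (DL.progress E ys (.not P)))))) ∧
    (∀ P R F G : DL.SAFormula L.toSignature, P.DiffFree → R.DiffFree →
      DL.IsProgressFormula T E P F → DL.IsProgressFormula T E R G →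
      DL.Derives T [] (P.toFormula.iff R.toFormula) →
      DL.Derives T [] (F.toFormula.iff G.toFormula)) := by
  open DL in
  have init : ∀ {ys M}, FreshFor E ys → MaxCon T M → ZeroDiffs M → (vecEq E ys).toFormula ∈ M →
      Initial T E ys M := fun hys hM hZ h => ⟨hM, hCont, hUniq, hE, hEv, hys, hZ, h⟩
  have hDF : ∀ {P F}, IsProgressFormula T E P F → F.DiffFree := by
    rintro P F ⟨D, ρ, hD, -, rfl⟩
    exact D.prog_diffFree hE fun p hp e he => (hD p hp e he).1
  refine ⟨fun P hP => exists_isProgressFormula hRad hE hP, fun P F ys hP hF hys _ => ⟨hDF hF, ?_⟩,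
    fun P ys hP hys _ => ?_, fun P R F G hP hR hF hG hPR => ?_⟩
  · refine .of_zeroDiffs (by simp) (fun w hw => ?_) fun M hM hZ _ => ?_
    · rw [fv_imp, fv_iff] at hw
      rcases Finset.mem_union.1 hw with hw | hw
      · exact (vecEq_diffFree E ys).order_toFormula hw
      · exact (Finset.mem_union.1 hw).elim (order_progress hE hP) (hDF hF).order_toFormula
    · rw [hM.mem_imp, hM.mem_iff]
      exact fun h => ((init hys hM hZ h).progress_iff hP hF).1
  -- Any progress formula serves as a go-between: progress into `P` holds exactly when `F` does, and
  -- progress into `¬P` exactly when `F` fails.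
  · obtain ⟨F, hF⟩ := exists_isProgressFormula hRad hE hP
    refine .of_zeroDiffs (by simp) (fun w hw => ?_) fun M hM hZ _ => ?_
    · rw [fv_imp, fv_iff] at hw
      rcases Finset.mem_union.1 hw with hw | hw
      · exact (vecEq_diffFree E ys).order_toFormula hw
      · exact (Finset.mem_union.1 hw).elim (order_progress hE hP)
          (order_progress hE (P := .not P) hP)
    · rw [hM.mem_imp, hM.mem_iff, hM.mem_not]
      intro h
      have := (init hys hM hZ h).progress_iff hP hF
      tauto
  -- The claim mentions no `y`, but progress needs names for the initial values. With a fresh `y`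
  -- and `x = y` assumed, `F` and `G` become progress into `P` and into `R`, which agree by
  -- monotonicity.
  · obtain ⟨ys, hys, hfresh⟩ := exists_freshFor E (F.toFormula.iff G.toFormula).fv
    refine .intro_vecEq hys (by simp) hfresh (.of_zeroDiffs ?_ (fun w hw => ?_) ?_)
    · intro χ hχ w hw
      obtain rfl := List.mem_singleton.1 hχ
      exact (vecEq_diffFree E ys).order_toFormula hw
    · rw [fv_iff] at hw
      exact (Finset.mem_union.1 hw).elim (hDF hF).order_toFormula (hDF hG).order_toFormula
    · intro M hM hZ h
      have hI := init hys hM hZ (h _ (by simp))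
      have hiff : ∀ M', MaxCon T M' → (P.toFormula ∈ M' ↔ R.toFormula ∈ M') :=
        fun M' hM' => hM'.mem_iff.1 (hM'.of_derives hPR)
      rw [hM.mem_iff, ← (hI.progress_iff hP hF).1, ← (hI.progress_iff hR hG).1]
      exact ⟨hI.progress_mono hP hR fun M' hM' => (hiff M' hM').1,
        hI.progress_mono hR hP fun M' hM' => (hiff M' hM').2⟩
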